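/- **Model.** For $x,y\in[0,1]$ let $d_L(x,y)=\min\{|x-y|,1-|x-y|\}$. Let $n$ be even and $V=V_1\sqcup V_2$ with $|V|=n$, $|V_1|=|V_2|=n/2$. In $\mathrm{GBM}(r_s,r_d)$ the vertices $u\in V$ get independent locations $X_u$, uniform on $[0,1]$, and distinct vertices $u,v$ are joined by an edge iff $d_L(X_u,X_v)\le r_s$ (when $u,v$ are in the same part), respectively $d_L(X_u,X_v)\le r_d$ (when they are in different parts). Only the graph is observed, not the $X_u$ or the parts. **Algorithm.** Given a graph $G=(V,E)$ on $n$ vertices and real thresholds $E_S,E_D$: for every edge $uv\in E$ compute $\mathrm{count}=|\{z: zu\in E,\ zv\in E\}|$, keep $uv$ if $\mathrm{count}/n\ge E_S$ or $\mathrm{count}/n\le E_D$, and remove it otherwise (all counts refer to the input graph). Return the connected components of the remaining graph. **Parameters.** Let $b>0$ and $a\ge 2b$ be fixed ($\log$ is the natural logarithm), and let $$T_1=\Big\{t>0:(2b+t)\log\tfrac{2b+t}{2b}-t>1\Big\},\qquad T_2=\Big\{t>0:(2b-t)\log\tfrac{2b-t}{2b}+t>1\Big\},$$ where $0\log 0=0$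 and the left-hand side in $T_2$ is read as $+\infty$ for $t>2b$. For $t_1>0$ and $t_2>0$ let $$\theta_1(t_1)=\sup\Big\{0\le\theta\le 2a-4b-2t_1:\ \tfrac12\Big((4b+2t_1)\log\tfrac{4b+2t_1}{2a-\theta}+2a-\theta-4b-2t_1\Big)>1\Big\},$$ $$\theta_2(t_2)=\inf\Big\{\max\{2b,2a-4b+2t_2\}\le\theta\le a:\ \tfrac12\Big((4b-2t_2)\log\tfrac{4b-2t_2}{2a-\theta}+2a-\theta-4b+2t_2\Big)>1\Big\},$$ with $\theta_1(t_1)=0$, respectively $\theta_2(t_2)=a$, if there is no such $\theta$. Say that condition $C(t_1,t_2)$ holds if $$a-\theta_2(t_2)+\theta_1(t_1)>2\qquad\text{or}\qquad\big(a-\theta_2(t_2)>1\ \text{ and }\ a>2\big).$$ **Theorem.** Say that $(s_1,s_2)$ *works* if, for $\mathrm{GBM}\big(\frac{a\log n}{n},\frac{b\log n}{n}\big)$, the algorithm with $E_S=(2b+s_1)\frac{\log n}{n}$ and $E_D=(2b-s_2)\frac{\log n}{n}$ returns exactly the two parts $V_1,V_2$ with probability $1-o(1)$ as $n\to\infty$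 through the even integers, for every choice of the parts. 1. Let $t_1=\inf T_1$ and $t_2=\inf T_2$. If $C(t_1,t_2)$ holds, then there is $\varepsilon>0$ such that every $(s_1,s_2)$ with $t_1<s_1<t_1+\varepsilon$ and $t_2<s_2<t_2+\varepsilon$ works. 2. More generally, if $t_1\in T_1$ and $t_2\in T_2$ are any numbers satisfying the strict inequalities and $C(t_1,t_2)$ holds, then $(t_1,t_2)$ works. 3. The algorithm is efficient: on every graph with $n$ vertices and for all thresholds, it takes a number of elementary steps (adjacency queries, arithmetic operations, comparisons, array reads and writes) that is at most a fixed polynomial in $n$. -/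

import Mathlib

/-! Geometric block model -/

namespace GBM

/-- The circular (geodesic) distance on `[0,1]`. -/
noncomputable def dL (x y : ℝ) : ℝ := min |x - y| (1 - |x - y|)

/-- The graph of the two-community geometric block model with radii `rs`, `rd`, communities `V₁`
and its complement, and vertex locations `X`. -/
def graph {n : ℕ} (V₁ : Finset (Fin n)) (rs rd : ℝ) (X : Fin n → ℝ) : SimpleGraph (Fin n) where
  Adj u v := u ≠ v ∧ (((u ∈ V₁ ↔ v ∈ V₁) ∧ dL (X u) (X v) ≤ rs) ∨
    (¬ (u ∈ V₁ ↔ v ∈ V₁) ∧ dL (X u) (X v) ≤ rd))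
  symm := ⟨fun u v h => by
    have hd : dL (X v) (X u) = dL (X u) (X v) := by simp only [dL, abs_sub_comm]
    have hi : (v ∈ V₁ ↔ u ∈ V₁) ↔ (u ∈ V₁ ↔ v ∈ V₁) := iff_comm
    rw [hd, hi]
    exact ⟨h.1.symm, h.2⟩⟩
  loopless := ⟨fun _ h => h.1 rfl⟩

/-- The law of the locations: independent and uniform on `[0,1]`. -/
noncomputable def locations (n : ℕ) : MeasureTheory.Measure (Fin n → ℝ) :=
  MeasureTheory.Measure.pi fun _ => (MeasureTheory.volume : MeasureTheory.Measure ℝ).restrict (Set.Icc 0 1)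

/-! Computations with a step count. The value and the number of elementary steps are carried
together; every query to the input graph, arithmetic operation, comparison, array read and array
write is charged one step through `Timed.op`. -/

/-- A value together with the number of elementary steps spent on computing it. -/
structure Timed (α : Type) where
  val : α
  steps : ℕ

instance : Monad Timed where
  pure x := ⟨x, 0⟩
  bind x f := ⟨(f x.val).val, x.steps + (f x.val).steps⟩

/-- One elementary step with result `x`. -/
def Timed.op {α : Type} (x : α) : Timed α := ⟨x, 1⟩

open Classical in
/-- Look up one entry of the adjacency matrix. -/
noncomputable def query {n : ℕ} (G : SimpleGraph (Fin n)) (u v : Fin n) : Timed Bool :=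
  Timed.op (decide (G.Adj u v))

/-- Count the common neighbours of `u` and `v` in `G`, i.e. the triangles on the edge `uv`. -/
noncomputable def commonCount {n : ℕ} (G : SimpleGraph (Fin n)) (u v : Fin n) : Timed ℕ :=
  (List.finRange n).foldlM (fun c z => do
    let p ← query G z u
    let q ← query G z v
    if p && q then Timed.op (c + 1) else pure c) 0

open Classical in
/-- The test on an edge `uv`: `true` (keep it) iff `count / n ≥ ES` or `count / n ≤ ED`. -/
noncomputable def process {n : ℕ} (G : SimpleGraph (Fin n)) (ES ED : ℝ) (u v : Fin n) :
    Timed Bool := do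
  let c ← commonCount G u v
  let x ← Timed.op ((c : ℝ) / n)
  let p ← Timed.op (decide (x ≥ ES))
  let q ← Timed.op (decide (x ≤ ED))
  Timed.op (p || q)

/-- Go over all edges of `G` and return the list of those that are not removed. -/
noncomputable def keptEdges {n : ℕ} (G : SimpleGraph (Fin n)) (ES ED : ℝ) :
    Timed (List (Fin n × Fin n)) :=
  (List.finRange n ×ˢ List.finRange n).foldlM (fun L e => do
    let edge ← query G e.1 e.2
    if edge then
      let keep ← process G ES ED e.1 e.2
      if keep then Timed.op (e :: L) else pure L
    else pure L) []

/-- Merge the classes of the two ends of `e`: every vertex that carries the label of `e.1` is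
given the label of `e.2`. -/
def merge {n : ℕ} (lab : Fin n → Fin n) (e : Fin n × Fin n) : Timed (Fin n → Fin n) := do
  let i ← Timed.op (lab e.1)
  let j ← Timed.op (lab e.2)
  (List.finRange n).foldlM (fun lab' w => do
    let k ← Timed.op (lab' w)
    let same ← Timed.op (decide (k = i))
    if same then Timed.op (Function.update lab' w j) else pure lab') lab

/-- The connected components of the graph on `Fin n` with edge list `L`, as a labelling of the
vertices: two vertices get the same label iff they are in the same component. All labels are
distinct at first (`n` array writes), then the ends of each edge are merged. -/
def connectedComponents {n : ℕ} (L : List (Fin n × Fin n)) : Timed (Fin n → Fin n) := do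
  let lab ← Timed.mk (id : Fin n → Fin n) n
  L.foldlM merge lab

/-- The recovery algorithm: remove the edges that fail the triangle-count test, and return the
connected components of what is left. -/
noncomputable def recoverClusters {n : ℕ} (G : SimpleGraph (Fin n)) (ES ED : ℝ) :
    Timed (Fin n → Fin n) := do
  let L ← keptEdges G ES ED
  connectedComponents L

/-- The threshold `E_S = (2b + t) log n / n`. -/
noncomputable def thresholdS (b t : ℝ) (n : ℕ) : ℝ := (2 * b + t) * (Real.log n / n)

/-- The threshold `E_D = (2b - t) log n / n`. -/
noncomputable def thresholdD (b t : ℝ) (n : ℕ) : ℝ := (2 * b - t) * (Real.log n / n)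

/-- The algorithm with thresholds `(2b + t₁) log n / n` and `(2b - t₂) log n / n` recovers the two
communities of `GBM(a log n / n, b log n / n)` exactly with probability `1 - o(1)`, as `n = 2m`
tends to infinity, whatever the two communities of size `m` are. -/
def RecoversWhp (a b t₁ t₂ : ℝ) : Prop :=
  ∀ V₁ : (m : ℕ) → Finset (Fin (2 * m)), (∀ m, (V₁ m).card = m) →
    Filter.Tendsto (fun m : ℕ => locations (2 * m)
      {X | ∀ u v : Fin (2 * m),
        (recoverClusters
            (graph (V₁ m) (a * Real.log (2 * m : ℕ) / (2 * m : ℕ))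
              (b * Real.log (2 * m : ℕ) / (2 * m : ℕ)) X)
            (thresholdS b t₁ (2 * m)) (thresholdD b t₂ (2 * m))).val u =
          (recoverClusters
            (graph (V₁ m) (a * Real.log (2 * m : ℕ) / (2 * m : ℕ))
              (b * Real.log (2 * m : ℕ) / (2 * m : ℕ)) X)
            (thresholdS b t₁ (2 * m)) (thresholdD b t₂ (2 * m))).val v ↔
          (u ∈ V₁ m ↔ v ∈ V₁ m)})
      Filter.atTop (nhds 1)

/-- The `t > 0` with `(2b + t) log ((2b + t) / 2b) - t > 1`. -/
def upperSet (b : ℝ) : Set ℝ :=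
  {t | 0 < t ∧ (2 * b + t) * Real.log ((2 * b + t) / (2 * b)) - t > 1}

/-- The `t > 0` with `(2b - t) log ((2b - t) / 2b) + t > 1`, where the left-hand side is `+∞` for
`t > 2b` (the usual convention for the rate function of a Poisson variable at negative values). -/
def lowerSet (b : ℝ) : Set ℝ :=
  {t | 0 < t ∧ (2 * b < t ∨ (2 * b - t) * Real.log ((2 * b - t) / (2 * b)) + t > 1)}

noncomputable def tOne (b : ℝ) : ℝ := sInf (upperSet b)

noncomputable def tTwo (b : ℝ) : ℝ := sInf (lowerSet b)

/-- `θ₁` as a function of `t₁`; it is `0` if no `θ` qualifies. -/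
noncomputable def thetaOne (a b t₁ : ℝ) : ℝ :=
  sSup (insert 0 {θ | 1 / 2 * ((4 * b + 2 * t₁) * Real.log ((4 * b + 2 * t₁) / (2 * a - θ))
      + 2 * a - θ - 4 * b - 2 * t₁) > 1 ∧ 0 ≤ θ ∧ θ ≤ 2 * a - 4 * b - 2 * t₁})

/-- `θ₂` as a function of `t₂`; it is `a` if no `θ` qualifies. -/
noncomputable def thetaTwo (a b t₂ : ℝ) : ℝ :=
  sInf (insert a {θ | 1 / 2 * ((4 * b - 2 * t₂) * Real.log ((4 * b - 2 * t₂) / (2 * a - θ))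
      + 2 * a - θ - 4 * b + 2 * t₂) > 1 ∧ max (2 * b) (2 * a - 4 * b + 2 * t₂) ≤ θ ∧ θ ≤ a})

/-- The recovery condition on `a`, `θ₁`, `θ₂`. -/
def Condition (a θ₁ θ₂ : ℝ) : Prop :=
  a - θ₂ + θ₁ > 2 ∨ (a - θ₂ > 1 ∧ a > 2)

end GBM

namespace GBM

/-! ### Timed computations -/

/-! Write `L = log n / n`. If `u` and `v` lie in different parts at distance at most `b L`, then `2
b ≤ a` makes the smaller of the two balls around them lie inside the larger, so every other vertex
is a common neighbour with probability exactly `2 b L`. If they lie in the same part at distance `x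
L`, the vertices of that part contribute `(2 a - x) L` each, and those of the other part contribute
nothing once `x > 2 b`; for a lower bound on the count they can be ignored.

Given the two locations, the count is a sum of independent indicators, and Chernoff's bound applies
(`measure_pair_tail_le`). It gives `n ^ (-ρ)` times the probability `O(L)` that the pair is close.
Summed over `n ^ 2` pairs this is `O(n ^ (1 - ρ) log n)`, so any exponent `ρ > 1` suffices
(`tendsto_measure_exists_pair`). With high probability, therefore, all cross edges are removed,
while inside a part all edges of normalized length below `s₁` or above `s₂` are kept, where `s₁` and
`s₂` approximate `θ₁` and `θ₂` (`exists_feasible`).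

It remains to connect each part through distances in `[0, s₁)` and `(s₂, a]`. Cut the circle into
about `K / L` cells. A cell misses a part of `n / 2` points with probability about `n ^ (-1 / (2
K))`, so with high probability no window of bounded length has more than `2 K` empty cells
(`tendsto_not_fewGaps`). The rest is deterministic (`exists_discretization`). If `a - s₂ + s₁ > 2`,
more than `2 K` cells can be reached to the right of any cell, so one of them is occupied and one
can always move right, until a long run of occupied cells joins everything (`related_of_steps`). If
only `a - s₂ > 1`, the cells reachable to the right of one cell and to the left of another number
more than `2 K` together, so two components cannot both get stuck nearby; `a > 2` closes the last
gap (`related_of_annulus`). -/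

theorem Timed.val_bind {α β : Type} (x : Timed α) (f : α → Timed β) :
    (x >>= f).val = (f x.val).val := rfl

theorem Timed.steps_bind {α β : Type} (x : Timed α) (f : α → Timed β) :
    (x >>= f).steps = x.steps + (f x.val).steps := rfl

theorem Timed.val_pure {α : Type} (x : α) : (pure x : Timed α).val = x := rfl

theorem Timed.val_op {α : Type} (x : α) : (Timed.op x).val = x := rfl

theorem Timed.steps_op {α : Type} (x : α) : (Timed.op x).steps = 1 := rfl

theorem Timed.steps_ite_le {α : Type} {c : Prop} [Decidable c] {x y : Timed α} {C : ℕ}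
    (hx : x.steps ≤ C) (hy : y.steps ≤ C) : (if c then x else y).steps ≤ C := by
  by_cases h : c
  · rwa [if_pos h]
  · rwa [if_neg h]

theorem Timed.val_foldlM {α β : Type} (f : β → α → Timed β) (l : List α) (x : β) :
    (l.foldlM f x).val = l.foldl (fun y e => (f y e).val) x := by
  induction l generalizing x with
  | nil => rfl
  | cons e l ih => rw [List.foldlM_cons, Timed.val_bind, ih]; rfl

theorem Timed.steps_foldlM_le {α β : Type} (f : β → α → Timed β) (C : ℕ)
    (hf : ∀ y e, (f y e).steps ≤ C) (l : List α) (x : β) :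
    (l.foldlM f x).steps ≤ l.length * C := by
  induction l generalizing x with
  | nil => exact Nat.zero_le _
  | cons e l ih =>
    rw [List.foldlM_cons, Timed.steps_bind, List.length_cons, Nat.succ_mul, add_comm]
    exact add_le_add (ih _) (hf _ _)

/-! ### The running time -/

theorem commonCount_steps_le {n : ℕ} (G : SimpleGraph (Fin n)) (u v : Fin n) :
    (commonCount G u v).steps ≤ n * 3 := by
  refine (Timed.steps_foldlM_le _ 3 ?_ _ _).trans_eq (by rw [List.length_finRange])
  intro c z
  simp only [Timed.steps_bind, query, Timed.steps_op, Timed.val_op]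
  rw [← add_assoc]
  exact Nat.add_le_add_left (Timed.steps_ite_le (C := 1) (Timed.steps_op _).le (Nat.zero_le _)) 2

theorem process_steps_le {n : ℕ} (G : SimpleGraph (Fin n)) (ES ED : ℝ) (u v : Fin n) :
    (process G ES ED u v).steps ≤ n * 3 + 4 := by
  have := commonCount_steps_le G u v
  simp only [process, Timed.steps_bind, Timed.steps_op]
  omega

theorem keptEdges_steps_le {n : ℕ} (G : SimpleGraph (Fin n)) (ES ED : ℝ) :
    (keptEdges G ES ED).steps ≤ n * n * (n * 3 + 6) := by
  refine (Timed.steps_foldlM_le _ (n * 3 + 6) ?_ _ _).trans_eq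
    (by rw [List.length_product, List.length_finRange])
  intro L e
  have := process_steps_le G ES ED e.1 e.2
  simp only [Timed.steps_bind, query, Timed.steps_op, Timed.val_op]
  rw [show n * 3 + 6 = 1 + (n * 3 + 4 + 1) by omega]
  refine Nat.add_le_add_left (Timed.steps_ite_le ?_ (Nat.zero_le _)) 1
  rw [Timed.steps_bind]
  exact add_le_add this (Timed.steps_ite_le (Timed.steps_op _).le (Nat.zero_le _))

theorem merge_steps_le {n : ℕ} (lab : Fin n → Fin n) (e : Fin n × Fin n) :
    (merge lab e).steps ≤ n * 3 + 2 := by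
  simp only [merge, Timed.steps_bind, Timed.steps_op, Timed.val_op]
  refine (Nat.add_le_add_left (Nat.add_le_add_left
    (Timed.steps_foldlM_le _ 3 (fun lab' w => ?_) _ _) _) _).trans ?_
  · simp only [Timed.steps_bind, Timed.steps_op, Timed.val_op]
    rw [← add_assoc]
    exact Nat.add_le_add_left (Timed.steps_ite_le (C := 1) (Timed.steps_op _).le (Nat.zero_le _)) 2
  · rw [List.length_finRange]
    omega

theorem connectedComponents_steps_le {n : ℕ} (L : List (Fin n × Fin n)) :
    (connectedComponents L).steps ≤ n + L.length * (n * 3 + 2) := by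
  simp only [connectedComponents, Timed.steps_bind]
  exact Nat.add_le_add_left (Timed.steps_foldlM_le _ _ merge_steps_le _ _) _

/-! ### Correctness -/

open Classical in
theorem commonCount_val {n : ℕ} (G : SimpleGraph (Fin n)) (u v : Fin n) :
    (commonCount G u v).val = (Finset.univ.filter fun z => G.Adj z u ∧ G.Adj z v).card := by
  have key : ∀ (l : List (Fin n)) (c : ℕ),
      (l.foldlM (fun c z => do
        let p ← query G z u
        let q ← query G z v
        if p && q then Timed.op (c + 1) else pure c) c : Timed ℕ).val =
      c + (l.filter fun z => G.Adj z u ∧ G.Adj z v).length := by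
    intro l
    induction l with
    | nil => intro c; rfl
    | cons z l ih =>
      intro c
      rw [List.foldlM_cons, Timed.val_bind, ih]
      simp only [Timed.val_bind, query, Timed.val_op, List.filter_cons]
      by_cases h1 : G.Adj z u <;> by_cases h2 : G.Adj z v <;>
        simp [h1, h2, Timed.val_op, Timed.val_pure, Nat.add_assoc, Nat.add_comm]
  rw [commonCount, key, Nat.zero_add]
  rfl

/-- The edges of `G` that the triangle-count test keeps. -/
def Kept {n : ℕ} (G : SimpleGraph (Fin n)) (ES ED : ℝ) (u v : Fin n) : Prop :=
  G.Adj u v ∧ (ES ≤ ((commonCount G u v).val : ℝ) / n ∨ ((commonCount G u v).val : ℝ) / n ≤ ED)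

open Classical in
theorem val_keptEdges_step {n : ℕ} (G : SimpleGraph (Fin n)) (ES ED : ℝ)
    (L : List (Fin n × Fin n)) (e : Fin n × Fin n) :
    (do let edge ← query G e.1 e.2
        if edge then
          let keep ← process G ES ED e.1 e.2
          if keep then Timed.op (e :: L) else pure L
        else pure L : Timed (List (Fin n × Fin n))).val =
      if Kept G ES ED e.1 e.2 then e :: L else L := by
  simp only [Timed.val_bind, query, Timed.val_op, process, Kept]
  by_cases h : G.Adj e.1 e.2
  · by_cases h1 : ES ≤ ((commonCount G e.1 e.2).val : ℝ) / n <;>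
      by_cases h2 : ((commonCount G e.1 e.2).val : ℝ) / n ≤ ED <;>
      simp [h, h1, h2, Timed.val_bind, Timed.val_op, Timed.val_pure]
  · simp [h, Timed.val_pure]

theorem foldl_cons_if_eq {α : Type} (p : α → Prop) [DecidablePred p] (l acc : List α) :
    l.foldl (fun L e => if p e then e :: L else L) acc = (l.filter p).reverse ++ acc := by
  induction l generalizing acc with
  | nil => rfl
  | cons e l ih =>
    rw [List.foldl_cons, ih, List.filter_cons]
    by_cases h : p e <;> simp [h]

open Classical in
theorem keptEdges_val {n : ℕ} (G : SimpleGraph (Fin n)) (ES ED : ℝ) :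
    (keptEdges G ES ED).val =
      ((List.finRange n ×ˢ List.finRange n).filter fun e => Kept G ES ED e.1 e.2).reverse := by
  rw [keptEdges, Timed.val_foldlM]
  simp only [val_keptEdges_step]
  rw [foldl_cons_if_eq (fun e : Fin n × Fin n => Kept G ES ED e.1 e.2), List.append_nil]

theorem mem_keptEdges {n : ℕ} (G : SimpleGraph (Fin n)) (ES ED : ℝ) (e : Fin n × Fin n) :
    e ∈ (keptEdges G ES ED).val ↔ Kept G ES ED e.1 e.2 := by
  classical
  rw [keptEdges_val, List.mem_reverse, List.mem_filter]
  have : e ∈ (List.finRange n ×ˢ List.finRange n) :=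
    List.mem_product.2 ⟨List.mem_finRange _, List.mem_finRange _⟩
  simp [this]

theorem length_keptEdges_le {n : ℕ} (G : SimpleGraph (Fin n)) (ES ED : ℝ) :
    (keptEdges G ES ED).val.length ≤ n * n := by
  classical
  rw [keptEdges_val, List.length_reverse]
  refine (List.length_filter_le _ _).trans_eq ?_
  rw [List.length_product, List.length_finRange]

/-- The loop updates in place but compares with the labels read before it started, and visits each
vertex once, so it acts as a simultaneous relabelling. -/
theorem merge_val {n : ℕ} (lab : Fin n → Fin n) (e : Fin n × Fin n) (w : Fin n) :
    (merge lab e).val w = if lab w = lab e.1 then lab e.2 else lab w := by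
  have key : ∀ (l : List (Fin n)), l.Nodup → ∀ lab' : Fin n → Fin n,
      (l.foldl (fun (y : Fin n → Fin n) z =>
        if y z = lab e.1 then Function.update y z (lab e.2) else y) lab') w =
      if w ∈ l ∧ lab' w = lab e.1 then lab e.2 else lab' w := by
    intro l
    induction l with
    | nil => intro _ lab'; simp
    | cons z l ih =>
      intro hl lab'
      rw [List.nodup_cons] at hl
      rw [List.foldl_cons, ih hl.2]
      by_cases hz : w = z
      · subst hz
        by_cases h : lab' w = lab e.1 <;> simp [h, hl.1]
      · by_cases h : lab' z = lab e.1 <;> simp [h, hz, Function.update_of_ne]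
  have h : (merge lab e).val = (List.finRange n).foldl (fun (y : Fin n → Fin n) z =>
        if y z = lab e.1 then Function.update y z (lab e.2) else y) lab := by
    simp only [merge, Timed.val_bind, Timed.val_op]
    rw [Timed.val_foldlM]
    congr 1
    funext y z
    simp only [Timed.val_bind, Timed.val_op]
    by_cases h : y z = lab e.1 <;> simp [h, Timed.val_op, Timed.val_pure]
  rw [h, key _ (List.nodup_finRange n)]
  simp [List.mem_finRange]

theorem connectedComponents_val {n : ℕ} (L : List (Fin n × Fin n)) :
    (connectedComponents L).val = L.foldl (fun lab e => (merge lab e).val) id := by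
  rw [connectedComponents, Timed.val_bind, Timed.val_foldlM]

/-- A label stays in any class of vertices that no edge leaves. -/
theorem label_mem_class {n : ℕ} {P : Fin n → Prop} {L : List (Fin n × Fin n)}
    (hL : ∀ e ∈ L, (P e.1 ↔ P e.2)) (w : Fin n) :
    P ((connectedComponents L).val w) ↔ P w := by
  rw [connectedComponents_val]
  have key : ∀ lab : Fin n → Fin n, (∀ w, P (lab w) ↔ P w) →
      ∀ w, P (L.foldl (fun lab e => (merge lab e).val) lab w) ↔ P w := by
    induction L with
    | nil => exact fun lab h => h
    | cons e L ih =>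
      intro lab h
      refine ih (fun e' he' => hL e' (List.mem_cons_of_mem _ he')) _ fun w => ?_
      change P ((merge lab e).val w) ↔ P w
      rw [merge_val]
      split_ifs with hw
      · rw [h, ← hL e List.mem_cons_self, ← h e.1, ← hw, h]
      · exact h w
  exact key id (fun _ => Iff.rfl) w

/-- A merge computes the new label from the old label alone, so labels that have become equal stay
equal. -/
theorem label_eq_of_mem {n : ℕ} {L : List (Fin n × Fin n)} {e : Fin n × Fin n} (he : e ∈ L) :
    (connectedComponents L).val e.1 = (connectedComponents L).val e.2 := by
  rw [connectedComponents_val]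
  have stay : ∀ (L : List (Fin n × Fin n)) (lab : Fin n → Fin n) (u v : Fin n), lab u = lab v →
      L.foldl (fun lab e => (merge lab e).val) lab u =
        L.foldl (fun lab e => (merge lab e).val) lab v := by
    intro L
    induction L with
    | nil => exact fun lab u v h => h
    | cons e L ih =>
      intro lab u v h
      exact ih _ u v (by simp only [merge_val, h])
  generalize (id : Fin n → Fin n) = lab
  induction L generalizing lab with
  | nil => cases he
  | cons e' L ih =>
    rcases List.mem_cons.1 he with rfl | he
    · refine stay L _ _ _ ?_
      simp only [merge_val]
      by_cases h : lab e.2 = lab e.1 <;> simp [h]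
    · exact ih he _

theorem recoverClusters_val {n : ℕ} (G : SimpleGraph (Fin n)) (ES ED : ℝ) :
    (recoverClusters G ES ED).val = (connectedComponents (keptEdges G ES ED).val).val := rfl

theorem recoverClusters_steps_le {n : ℕ} (G : SimpleGraph (Fin n)) (ES ED : ℝ) :
    (recoverClusters G ES ED).steps ≤ n * n * (n * 3 + 6) + (n + n * n * (n * 3 + 2)) := by
  rw [recoverClusters, Timed.steps_bind]
  refine add_le_add (keptEdges_steps_le G ES ED) ((connectedComponents_steps_le _).trans ?_)
  exact Nat.add_le_add_left (Nat.mul_le_mul_right _ (length_keptEdges_le G ES ED)) _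

/-- The running time is polynomial in the number of vertices. -/
theorem exists_polynomial_steps_le :
    ∃ p : Polynomial ℕ, ∀ (n : ℕ) (G : SimpleGraph (Fin n)) (ES ED : ℝ),
      (recoverClusters G ES ED).steps ≤ p.eval n := by
  refine ⟨.X * .X * (.X * 3 + 6) + (.X + .X * .X * (.X * 3 + 2)), fun n G ES ED => ?_⟩
  refine (recoverClusters_steps_le G ES ED).trans_eq ?_
  simp

/-- If the kept edges stay inside the two parts, and every equivalence relation that contains
the kept edges relates any two vertices of the same part, the labelling recovers the parts. -/
theorem label_eq_iff {n : ℕ} {G : SimpleGraph (Fin n)} {ES ED : ℝ} {V : Finset (Fin n)}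
    (hcross : ∀ u v, Kept G ES ED u v → (u ∈ V ↔ v ∈ V))
    (hconn : ∀ r : Setoid (Fin n), (∀ u v, Kept G ES ED u v → r u v) →
      ∀ u v, (u ∈ V ↔ v ∈ V) → r u v) (u v : Fin n) :
    (recoverClusters G ES ED).val u = (recoverClusters G ES ED).val v ↔ (u ∈ V ↔ v ∈ V) := by
  rw [recoverClusters_val]
  constructor
  · intro h
    have hL : ∀ e ∈ (keptEdges G ES ED).val, (e.1 ∈ V ↔ e.2 ∈ V) := fun e he =>
      hcross _ _ ((mem_keptEdges G ES ED e).1 he)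
    rw [← label_mem_class (P := fun w => w ∈ V) hL u, h, label_mem_class (P := fun w => w ∈ V) hL v]
  · intro h
    -- Having the same label is itself an equivalence relation containing the kept edges, so no
    -- paths are needed.
    exact hconn (Setoid.ker (connectedComponents (keptEdges G ES ED).val).val)
      (fun u v huv => label_eq_of_mem (e := (u, v)) ((mem_keptEdges G ES ED (u, v)).2 huv)) u v h

end GBM

namespace GBM

/-! ### Connectivity of sets of integers with few gaps -/

/-- Every `k` cells inside a window of length `M` contain an element of `O`. -/
def FewGaps (O : Set ℤ) (M : ℤ) (k : ℕ) : Prop :=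
  ∀ x : ℤ, ∀ F ⊆ Finset.Ico x (x + M), k ≤ F.card → ∃ i ∈ F, i ∈ O

/-- Pigeonhole: `k` disjoint blocks of length `l` fit into the window, and a hole in each would give
`k` empty cells. -/
theorem FewGaps.exists_run {O : Set ℤ} {M : ℤ} {k : ℕ} (h : FewGaps O M k) {l : ℤ} (hl : 0 ≤ l)
    (hM : k * l ≤ M) (x : ℤ) :
    ∃ y, x ≤ y ∧ y + l ≤ x + k * l ∧ ∀ i, y ≤ i → i < y + l → i ∈ O := by
  by_contra! hc
  have hc' : ∀ t : ℕ, t < k → ∃ i, x + t * l ≤ i ∧ i < x + t * l + l ∧ i ∉ O := by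
    intro t ht
    refine hc (x + t * l) (by nlinarith) ?_
    have : ((t : ℤ) + 1) ≤ k := by exact_mod_cast ht
    nlinarith
  choose! f hf1 hf2 hf3 using hc'
  have hinj : Set.InjOn f (Finset.range k : Set ℕ) := by
    have hlt : ∀ s t : ℕ, s < k → t < k → s < t → f s < f t := by
      intro s t hs ht hst
      have h1 := hf2 s hs
      have h2 := hf1 t ht
      have : ((s : ℤ) + 1) ≤ t := by exact_mod_cast hst
      nlinarith
    intro s hs t ht hst
    rw [Finset.mem_coe, Finset.mem_range] at hs ht
    rcases lt_trichotomy s t with h | h | h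
    · exact absurd hst (hlt s t hs ht h).ne
    · exact h
    · exact absurd hst (hlt t s ht hs h).ne'
  obtain ⟨i, hi, hiO⟩ := h x ((Finset.range k).image f) (by
    intro i hi
    obtain ⟨t, ht, rfl⟩ := Finset.mem_image.1 hi
    rw [Finset.mem_range] at ht
    have h1 := hf1 t ht
    have h2 := hf2 t ht
    have : ((t : ℤ) + 1) ≤ k := by exact_mod_cast ht
    rw [Finset.mem_Ico]
    constructor <;> nlinarith) (by rw [Finset.card_image_of_injOn hinj, Finset.card_range])
  obtain ⟨t, ht, rfl⟩ := Finset.mem_image.1 hi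
  exact hf3 t (Finset.mem_range.1 ht) hiO

section

variable {O : Set ℤ} {R : ℤ → ℤ → Prop} (hsymm : ∀ i j, R i j → R j i)
  (htrans : ∀ i j k, j ∈ O → R i j → R j k → R i k)

include hsymm htrans

/-- Neighbouring cells `j` and `j + 1` are both joined to `j + 1 + e`, at differences `e + 1` and
`e`. -/
theorem related_of_run {e : ℤ} (he : 0 ≤ e)
    (hR : ∀ i j, i ∈ O → j ∈ O → e ≤ j - i → j - i ≤ e + 1 → R i j) {y l : ℤ}
    (hrun : ∀ i, y ≤ i → i < y + l → i ∈ O) {i j : ℤ} (hi : y ≤ i) (hi' : i + e + 1 < y + l)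
    (hj : y ≤ j) (hj' : j + e + 1 < y + l) : R i j := by
  have key : ∀ i, y ≤ i → ∀ j, i ≤ j → j + e + 1 < y + l → R i j := by
    intro i hi j hij
    induction j, hij using Int.leInduction with
    | base =>
      intro h
      -- `R` is not assumed reflexive, so `R i i` is obtained by going to `i + e` and back.
      have hO := hrun (i + e) (by omega) (by omega)
      have h1 := hR i (i + e) (hrun i hi (by omega)) hO (by omega) (by omega)
      exact htrans _ _ _ hO h1 (hsymm _ _ h1)
    | succ j hij ih =>
      intro h
      have hOj := hrun j (by omega) (by omega)
      have hO := hrun (j + 1 + e) (by omega) (by omega)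
      have h1 := hR j (j + 1 + e) hOj hO (by omega) (by omega)
      have h2 := hR (j + 1) (j + 1 + e) (hrun _ (by omega) (by omega)) hO (by omega) (by omega)
      exact htrans _ _ _ hOj (ih (by omega)) (htrans _ _ _ hO h1 (hsymm _ _ h2))
  rcases le_total i j with h | h
  · exact key i hi j h hj'
  · exact hsymm _ _ (key j hj i h hi')

/-- Connectivity when the differences in `D` allow a step to the right from every cell. -/
theorem related_of_steps {M : ℤ} {k : ℕ} (h : FewGaps O M k) {D : Finset ℤ} {Q e : ℤ}
    (hDQ : ∀ d ∈ D, 1 ≤ d ∧ d ≤ Q) (hk : 1 ≤ k) (hD : k ≤ D.card) (he : e ∈ D) (he' : e + 1 ∈ D)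
    (hM : k * (2 * Q + 2) ≤ M)
    (hR : ∀ i j, i ∈ O → j ∈ O → j - i ∈ D → R i j) {i j : ℤ} (hi : i ∈ O) (hj : j ∈ O) :
    R i j := by
  have hQ := hDQ e he
  have hQ' := hDQ _ he'
  have hk' : (1 : ℤ) ≤ k := by exact_mod_cast hk
  have hstep : ∀ i ∈ O, ∃ d ∈ D, i + d ∈ O := by
    intro i hi
    obtain ⟨j, hj, hjO⟩ := h (i + 1) (D.image (i + ·)) (by
      intro j hj
      obtain ⟨d, hd, rfl⟩ := Finset.mem_image.1 hj
      have := hDQ d hd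
      rw [Finset.mem_Ico]
      constructor <;> nlinarith)
      (by rwa [Finset.card_image_of_injective _ (add_right_injective i)])
    obtain ⟨d, hd, rfl⟩ := Finset.mem_image.1 hj
    exact ⟨d, hd, hjO⟩
  -- Cells live on the line that covers the circle, so some run lies to the right of both `i` and
  -- `j`.
  obtain ⟨y, hy, -, hrun⟩ := h.exists_run (l := 2 * Q + 2) (by omega) hM (max i j)
  -- A step has length at most `Q`, so moving right from below `y` cannot jump over the first `Q`
  -- cells of the run.
  have hreach : ∀ n : ℕ, ∀ i ∈ O, y - i ≤ n → i < y + Q →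
      ∃ j ∈ O, y ≤ j ∧ j < y + Q ∧ (i = j ∨ R i j) := by
    intro n
    induction n with
    | zero => exact fun i hi h1 h2 => ⟨i, hi, by push_cast at h1; omega, h2, Or.inl rfl⟩
    | succ n ih =>
      intro i hi h1 h2
      by_cases hyi : y ≤ i
      · exact ⟨i, hi, hyi, h2, Or.inl rfl⟩
      · obtain ⟨d, hd, hdO⟩ := hstep i hi
        have := hDQ d hd
        obtain ⟨j, hj, hj1, hj2, hj3⟩ := ih (i + d) hdO (by push_cast at h1; omega) (by omega)
        have hid : R i (i + d) := hR _ _ hi hdO (by rwa [add_sub_cancel_left])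
        refine ⟨j, hj, hj1, hj2, Or.inr ?_⟩
        rcases hj3 with rfl | hj3
        · exact hid
        · exact htrans _ _ _ hdO hid hj3
  have hi1 := le_max_left i j
  have hj1 := le_max_right i j
  obtain ⟨i', hi', hi1, hi2, hi3⟩ := hreach (y - i).toNat i hi (by omega) (by omega)
  obtain ⟨j', hj', hj1, hj2, hj3⟩ := hreach (y - j).toNat j hj (by omega) (by omega)
  have hij : R i' j' := related_of_run hsymm htrans (e := e) (by omega) (fun i j hi hj h1 h2 => by
    refine hR i j hi hj ?_
    rcases (show j - i = e ∨ j - i = e + 1 by omega) with h | h <;> rw [h] <;> assumption)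
    hrun hi1 (by omega) hj1 (by omega)
  have h1 : R i j' := by
    rcases hi3 with rfl | hi3
    · exact hij
    · exact htrans _ _ _ hi' hi3 hij
  rcases hj3 with rfl | hj3
  · exact h1
  · exact htrans _ _ _ hj' h1 (hsymm _ _ hj3)

/-- Two consecutive runs of an annulus graph are connected, with everything in between. -/
theorem related_between_runs {M : ℤ} {k : ℕ} (h : FewGaps O M k) {p q : ℤ}
    (hp : 1 ≤ p) (hpq : p < q) (hkw : k ≤ 2 * (q - p + 1)) (hkq : k ≤ q)
    (hR : ∀ i j, i ∈ O → j ∈ O → p ≤ j - i → j - i ≤ q → R i j) {y₁ y₂ : ℤ} (hy : y₁ + q ≤ y₂)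
    (hM : y₂ + q ≤ y₁ + M)
    (hrun₁ : ∀ i, y₁ ≤ i → i < y₁ + (2 * q + 2) → i ∈ O)
    (hrun₂ : ∀ i, y₂ ≤ i → i < y₂ + (2 * q + 2) → i ∈ O) {z : ℤ} (hz : z ∈ O) (hz1 : y₁ ≤ z)
    (hz2 : z < y₂ + q) : R z y₁ ∧ R z y₂ := by
  classical
  have hR' : ∀ i j, i ∈ O → j ∈ O → p ≤ j - i → j - i ≤ p + 1 → R i j :=
    fun i j hi hj h1 h2 => hR i j hi hj h1 (by omega)
  have hr₁ : ∀ c, y₁ ≤ c → c < y₁ + q → R c y₁ := fun c h1 h2 =>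
    related_of_run hsymm htrans (by omega) hR' hrun₁ h1 (by omega) le_rfl (by omega)
  have hr₂ : ∀ c, y₂ ≤ c → c < y₂ + q → R c y₂ := fun c h1 h2 =>
    related_of_run hsymm htrans (by omega) hR' hrun₂ h1 (by omega) le_rfl (by omega)
  have hO₁ := hrun₁ y₁ le_rfl (by omega)
  have hO₂ := hrun₂ y₂ le_rfl (by omega)
  -- `c` is the rightmost cell of the component of `z` in this stretch. As it lies left of `y₂`, the
  -- cells `c + d` are still in the stretch, and by maximality all are empty.
  have hmax : ∀ z ∈ O, y₁ ≤ z → z < y₂ + q → ¬ R z y₂ → ∃ c ∈ O, z ≤ c ∧ c < y₂ ∧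
      (c = z ∨ R z c) ∧ (∀ d, p ≤ d → d ≤ q → c + d ∉ O) ∧
      ∀ c' ∈ O, y₁ ≤ c' → c' < y₂ + q → R z c' → c' ≤ c := by
    intro z hz hz1 hz2 hzR
    obtain ⟨c, hc, hcmax⟩ := ((Finset.Ico y₁ (y₂ + q)).filter
      fun c => c ∈ O ∧ (c = z ∨ R z c)).exists_max_image id
      ⟨z, by simp [hz, hz1, hz2]⟩
    simp only [Finset.mem_filter, Finset.mem_Ico, id] at hc hcmax
    obtain ⟨⟨hc1, hc2⟩, hcO, hcz⟩ := hc
    have hlt : c < y₂ := by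
      by_contra hge
      have := hr₂ c (by omega) hc2
      rcases hcz with rfl | hcz
      · exact hzR this
      · exact hzR (htrans _ _ _ hcO hcz this)
    refine ⟨c, hcO, hcmax z ⟨⟨hz1, hz2⟩, hz, Or.inl rfl⟩, hlt, hcz, fun d hd1 hd2 hdO => ?_,
      fun c' h1 h2 h3 h4 => hcmax c' ⟨⟨h2, h3⟩, h1, Or.inr h4⟩⟩
    have h1 : R c (c + d) := hR _ _ hcO hdO (by omega) (by omega)
    have h2 : R z (c + d) := by
      rcases hcz with rfl | hcz
      · exact h1
      · exact htrans _ _ _ hcO hcz h1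
    have := hcmax (c + d) ⟨⟨by omega, by omega⟩, hdO, Or.inr h2⟩
    omega
  have hmin : ∀ z ∈ O, y₁ ≤ z → z < y₂ + q → ¬ R z y₁ → ∃ c ∈ O, c ≤ z ∧ y₁ + q ≤ c ∧
      (c = z ∨ R z c) ∧ (∀ d, p ≤ d → d ≤ q → c - d ∉ O) ∧
      ∀ c' ∈ O, y₁ ≤ c' → c' < y₂ + q → R z c' → c ≤ c' := by
    intro z hz hz1 hz2 hzR
    obtain ⟨c, hc, hcmin⟩ := ((Finset.Ico y₁ (y₂ + q)).filter
      fun c => c ∈ O ∧ (c = z ∨ R z c)).exists_min_image id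
      ⟨z, by simp [hz, hz1, hz2]⟩
    simp only [Finset.mem_filter, Finset.mem_Ico, id] at hc hcmin
    obtain ⟨⟨hc1, hc2⟩, hcO, hcz⟩ := hc
    have hge : y₁ + q ≤ c := by
      by_contra hlt
      have := hr₁ c hc1 (by omega)
      rcases hcz with rfl | hcz
      · exact hzR this
      · exact hzR (htrans _ _ _ hcO hcz this)
    refine ⟨c, hcO, hcmin z ⟨⟨hz1, hz2⟩, hz, Or.inl rfl⟩, hge, hcz, fun d hd1 hd2 hdO => ?_,
      fun c' h1 h2 h3 h4 => hcmin c' ⟨⟨h2, h3⟩, h1, Or.inr h4⟩⟩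
    have h1 : R c (c - d) := hsymm _ _ (hR _ _ hdO hcO (by omega) (by omega))
    have h2 : R z (c - d) := by
      rcases hcz with rfl | hcz
      · exact h1
      · exact htrans _ _ _ hcO hcz h1
    have := hcmin (c - d) ⟨⟨by omega, by omega⟩, hdO, Or.inr h2⟩
    omega
  -- Two stuck cells leave `2 * (q - p + 1) ≥ k` empty cells in one window, provided the two blocked
  -- intervals are disjoint.
  have hcontra : ∀ c₁ c₂, y₁ ≤ c₁ → c₁ < y₂ → y₁ + q ≤ c₂ → c₂ < y₂ + q → c₂ - p < c₁ + p →
      (∀ d, p ≤ d → d ≤ q → c₁ + d ∉ O) → (∀ d, p ≤ d → d ≤ q → c₂ - d ∉ O) → False := by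
    intro c₁ c₂ h1 h2 h3 h4 h5 h6 h7
    obtain ⟨i, hi, hiO⟩ := h y₁ (Finset.Icc (c₂ - q) (c₂ - p) ∪ Finset.Icc (c₁ + p) (c₁ + q)) (by
      intro i hi
      simp only [Finset.mem_union, Finset.mem_Icc] at hi
      rw [Finset.mem_Ico]
      omega) (by
      rw [Finset.card_union_of_disjoint, Int.card_Icc, Int.card_Icc]
      · omega
      · rw [Finset.disjoint_left]
        intro i hi hi'
        rw [Finset.mem_Icc] at hi hi'
        omega)
    simp only [Finset.mem_union, Finset.mem_Icc] at hi
    rcases hi with hi | hi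
    · exact h7 (c₂ - i) (by omega) (by omega) (by rwa [sub_sub_cancel])
    · exact h6 (i - c₁) (by omega) (by omega) (by rwa [add_sub_cancel])
  -- The extreme cells of one component satisfy `c₂ ≤ z ≤ c₁`, so their blocked intervals lie on
  -- opposite sides of `z`.
  have hor : ∀ z ∈ O, y₁ ≤ z → z < y₂ + q → R z y₁ ∨ R z y₂ := by
    intro z hz hz1 hz2
    by_contra! hc
    obtain ⟨c₁, -, h1, h2, -, h3, -⟩ := hmax z hz hz1 hz2 hc.2
    obtain ⟨c₂, -, h4, h5, -, h6, -⟩ := hmin z hz hz1 hz2 hc.1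
    exact hcontra c₁ c₂ (by omega) h2 h5 (by omega) (by omega) h3 h6
  have h12 : R y₁ y₂ := by
    by_contra hc
    obtain ⟨c₁, hc₁, h1, h2, h3, h4, h5⟩ := hmax y₁ hO₁ le_rfl (by omega) hc
    obtain ⟨c₂, hc₂, h6, h7, h8, h9, h10⟩ := hmin y₂ hO₂ (by omega) (by omega)
      fun h => hc (hsymm _ _ h)
    refine hcontra c₁ c₂ h1 h2 h7 (by omega) ?_ h4 h9
    -- Otherwise the extreme cells of the two runs' components are at least `2 * p` apart. An
    -- occupied cell between them would belong to one component and contradict its extremality, so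
    -- they are at most `k ≤ q` apart and hence directly joined.
    by_contra! hlt
    have hgap : c₂ - c₁ ≤ k := by
      by_contra! hgap
      obtain ⟨i, hi, hiO⟩ := h y₁ (Finset.Ioo c₁ c₂) (by
        intro i hi
        rw [Finset.mem_Ioo] at hi
        rw [Finset.mem_Ico]
        omega) (by rw [Int.card_Ioo]; omega)
      rw [Finset.mem_Ioo] at hi
      rcases hor i hiO (by omega) (by omega) with h | h
      · have := h5 i hiO (by omega) (by omega) (hsymm _ _ h)
        omega
      · have := h10 i hiO (by omega) (by omega) (hsymm _ _ h)
        omega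
    have h12 : R c₁ c₂ := hR _ _ hc₁ hc₂ (by omega) (by omega)
    have h12' : R y₁ c₂ := by
      rcases h3 with rfl | h3
      · exact h12
      · exact htrans _ _ _ hc₁ h3 h12
    rcases h8 with rfl | h8
    · exact hc h12'
    · exact hc (htrans _ _ _ hc₂ h12' (hsymm _ _ h8))
  rcases hor z hz hz1 hz2 with h | h
  · exact ⟨h, htrans _ _ _ hO₁ h h12⟩
  · exact ⟨htrans _ _ _ hO₂ h (hsymm _ _ h12), h⟩

/-- Connectivity of the annulus graph. -/
theorem related_of_annulus {M : ℤ} {k : ℕ} (h : FewGaps O M k) {p q : ℤ} (hk : 1 ≤ k)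
    (hp : 1 ≤ p) (hpq : p < q) (hkw : k ≤ 2 * (q - p + 1)) (hkq : k ≤ q)
    (hM : 2 * (k * (2 * q + 2)) ≤ M)
    (hR : ∀ i j, i ∈ O → j ∈ O → p ≤ j - i → j - i ≤ q → R i j) {i j : ℤ} (hi : i ∈ O)
    (hj : j ∈ O) : R i j := by
  have hk' : (1 : ℤ) ≤ k := by exact_mod_cast hk
  obtain ⟨W, hW⟩ : ∃ W : ℤ, W = k * (2 * q + 2) := ⟨_, rfl⟩
  have hW1 : 2 * q + 2 ≤ W := by nlinarith
  -- One run in every block of length `W`: consecutive runs then fit into a window of length `2 * W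
  -- ≤ M`.
  choose y hy1 hy2 hrun using fun t : ℤ =>
    h.exists_run (l := 2 * q + 2) (by omega) (by omega) (t * W)
  rw [← hW] at hM
  simp only [← hW] at hy2
  have hbetween : ∀ t : ℤ, ∀ z ∈ O, y t ≤ z → z < y (t + 1) + q → R z (y t) ∧ R z (y (t + 1)) := by
    intro t z hz h1 h2
    have e1 := hy1 t
    have e2 := hy2 t
    have e3 := hy1 (t + 1)
    have e4 := hy2 (t + 1)
    rw [add_mul, one_mul] at e3 e4
    exact related_between_runs hsymm htrans h hp hpq hkw hkq hR (by omega) (by omega) (hrun t)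
      (hrun (t + 1)) hz h1 h2
  have hyO : ∀ t, y t ∈ O := fun t => hrun t _ le_rfl (by omega)
  have hnext : ∀ t, y t < y (t + 1) := fun t => by
    have e2 := hy2 t
    have e3 := hy1 (t + 1)
    rw [add_mul, one_mul] at e3
    omega
  have hyy : ∀ s t, s ≤ t → R (y s) (y t) := by
    intro s t hst
    induction t, hst using Int.leInduction with
    | base => exact (hbetween s _ (hyO s) le_rfl (by have := hnext s; omega)).1
    | succ t hst ih =>
      exact htrans _ _ _ (hyO t) ih (hbetween t _ (hyO t) le_rfl (by have := hnext t; omega)).2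
  have hyy' : ∀ s t, R (y s) (y t) := fun s t =>
    (le_total s t).elim (hyy s t) fun h => hsymm _ _ (hyy t s h)
  have hloc : ∀ i ∈ O, ∃ t, R i (y t) := by
    intro i hi
    have h1 := Int.mul_ediv_add_emod i W
    have h2 := Int.emod_nonneg i (show W ≠ 0 by omega)
    have h3 := Int.emod_lt_of_pos i (show 0 < W by omega)
    rw [mul_comm] at h1
    generalize i / W = t at h1
    have e1 := hy1 t
    by_cases hlt : i < y t
    · refine ⟨t - 1, (hbetween (t - 1) i hi ?_ ?_).1⟩
      · have := hy2 (t - 1)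
        rw [sub_mul, one_mul] at this
        omega
      · rw [sub_add_cancel]; omega
    · refine ⟨t, (hbetween t i hi (by omega) ?_).1⟩
      have := hy1 (t + 1)
      rw [add_mul, one_mul] at this
      omega
  obtain ⟨s, hs⟩ := hloc i hi
  obtain ⟨t, ht⟩ := hloc j hj
  exact htrans _ _ _ (hyO s) hs (htrans _ _ _ (hyO t) (hyy' s t) (hsymm _ _ ht))

end

end GBM

namespace GBM

open Filter Topology

/-! ### Chernoff exponents -/

/-- The Chernoff exponent of the upper tail at `2b + t` of a count of mean `2b` exceeds `1`. -/
def CrossUpper (b t : ℝ) : Prop :=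
  ∃ g, 1 < g ∧ 1 < (2 * b + t) * Real.log g - (g - 1) * (2 * b)

/-- The Chernoff exponent of the lower tail at `2b - t` of a count of mean `2b` exceeds `1`. -/
def CrossLower (b t : ℝ) : Prop :=
  ∃ g, 0 < g ∧ g < 1 ∧ 1 < (1 - g) * (2 * b) + (2 * b - t) * Real.log g

/-- The exponent of the lower tail at `2b + t` of a count of mean `(2a - s) / 2` exceeds `1`. -/
def NearExponent (a b t s : ℝ) : Prop :=
  ∃ g, 0 < g ∧ g ≤ 1 ∧ 1 < (1 - g) * ((2 * a - s) / 2) + (2 * b + t) * Real.log g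

/-- The exponent of the upper tail at `2b - t` of a count of mean `(2a - s) / 2` exceeds `1`. -/
def FarExponent (a b t s : ℝ) : Prop :=
  ∃ g, 1 ≤ g ∧ 1 < (2 * b - t) * Real.log g - (g - 1) * ((2 * a - s) / 2)

/-- The distances below `s₁` and those above `s₂` suffice for connectivity. -/
def Spread (a s₁ s₂ : ℝ) : Prop :=
  s₁ ≤ s₂ ∧ 2 < a - s₂ + s₁ ∨ 1 < a - s₂ ∧ 2 < a

/-- Edges of normalized length below `s₁` or above `s₂` are kept with high probability, and such
edges suffice for connectivity. -/
structure Feasible (a b t₁ t₂ s₁ s₂ : ℝ) : Prop where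
  nonneg : 0 ≤ s₁
  nonneg' : 0 ≤ s₂
  le : s₂ ≤ a
  near : s₁ = 0 ∨ NearExponent a b t₁ s₁
  far : s₂ = a ∨ (2 * b ≤ s₂ ∧ FarExponent a b t₂ s₂)
  spread : Spread a s₁ s₂

theorem crossUpper_of_mem {b t : ℝ} (hb : 0 < b) (ht : t ∈ upperSet b) : CrossUpper b t := by
  obtain ⟨h0, h1⟩ := ht
  refine ⟨(2 * b + t) / (2 * b), ?_, ?_⟩
  · rw [one_lt_div (by positivity)]; linarith
  · have : ((2 * b + t) / (2 * b) - 1) * (2 * b) = t := by field_simp; ring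
    rw [this]
    exact h1

theorem CrossUpper.mono {b t s : ℝ} (h : CrossUpper b t) (hts : t ≤ s) : CrossUpper b s := by
  obtain ⟨g, hg, h⟩ := h
  have := Real.log_pos hg
  exact ⟨g, hg, by nlinarith⟩

theorem crossLower_of_mem {b t : ℝ} (hb : 0 < b) (ht : t ∈ lowerSet b) : CrossLower b t := by
  obtain ⟨h0, h1⟩ := ht
  rcases lt_trichotomy t (2 * b) with h | h | h
  · rcases h1 with h1 | h1
    · exact absurd h1 h.le.not_gt
    refine ⟨(2 * b - t) / (2 * b), div_pos (by linarith) (by positivity), ?_, ?_⟩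
    · rw [div_lt_one (by positivity)]; linarith
    · have : (1 - (2 * b - t) / (2 * b)) * (2 * b) = t := by field_simp; ring
      rw [this]
      linarith
  · rcases h1 with h1 | h1
    · exact absurd h1 h.not_gt
    rw [h] at h1
    simp only [sub_self, zero_mul, zero_add] at h1
    have h2 : 1 / (2 * b) < 1 := by rw [div_lt_one (by positivity)]; exact h1
    have h3 : 0 < 1 / (2 * b) := by positivity
    -- At `t = 2 b` the supremum `2 b > 1` is only approached as `g → 0`; this `g` gives the
    -- midpoint `b + 1 / 2` between `1` and `2 b`.
    refine ⟨(1 - 1 / (2 * b)) / 2, by linarith, by linarith, ?_⟩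
    have : (1 - (1 - 1 / (2 * b)) / 2) * (2 * b) = b + 1 / 2 := by field_simp; ring
    rw [h, sub_self, zero_mul, add_zero, this]
    linarith
  · have h2 : 0 < t - 2 * b := by linarith
    have h3 : Real.exp (-(2 / (t - 2 * b))) < 1 := by
      rw [Real.exp_lt_one_iff, neg_lt_zero]; positivity
    -- For `t > 2 b` the exponent is unbounded as `g → 0`; this `g` makes the logarithmic term equal
    -- to `2`.
    refine ⟨Real.exp (-(2 / (t - 2 * b))), Real.exp_pos _, h3, ?_⟩
    rw [Real.log_exp]
    have : (2 * b - t) * -(2 / (t - 2 * b)) = 2 := by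
      field_simp; ring
    rw [this]
    have : 0 < (1 - Real.exp (-(2 / (t - 2 * b)))) * (2 * b) :=
      mul_pos (by linarith) (by positivity)
    linarith

theorem CrossLower.mono {b t s : ℝ} (h : CrossLower b t) (hts : t ≤ s) : CrossLower b s := by
  obtain ⟨g, hg, hg1, h⟩ := h
  have := Real.log_neg hg hg1
  exact ⟨g, hg, hg1, by nlinarith⟩

theorem upperSet_nonempty {b : ℝ} (hb : 0 < b) : (upperSet b).Nonempty := by
  have hy : 1 < Real.exp (1 + 1 / (2 * b)) := Real.one_lt_exp_iff.2 (by positivity)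
  -- With `y = exp (1 + 1 / (2 b))` and `2 b + t = 2 b y`, the rate equals `y + 2 b`.
  refine ⟨2 * b * Real.exp (1 + 1 / (2 * b)) - 2 * b, by nlinarith, ?_⟩
  rw [add_sub_cancel, mul_div_cancel_left₀ _ (by positivity), Real.log_exp]
  have : 2 * b * Real.exp (1 + 1 / (2 * b)) * (1 + 1 / (2 * b)) =
      2 * b * Real.exp (1 + 1 / (2 * b)) + Real.exp (1 + 1 / (2 * b)) := by
    field_simp
  rw [this]
  linarith

theorem lowerSet_nonempty {b : ℝ} (hb : 0 < b) : (lowerSet b).Nonempty :=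
  ⟨2 * b + 1, by linarith, Or.inl (by linarith)⟩

theorem tOne_nonneg (b : ℝ) : 0 ≤ tOne b := Real.sInf_nonneg fun _ h => h.1.le

theorem tTwo_nonneg (b : ℝ) : 0 ≤ tTwo b := Real.sInf_nonneg fun _ h => h.1.le

/-- Nothing is claimed at the infimum itself: a member of the set below `t` exists, and the exponent
is monotone in the threshold. -/
theorem crossUpper_of_gt {b t : ℝ} (hb : 0 < b) (ht : tOne b < t) : CrossUpper b t := by
  obtain ⟨s, hs, hst⟩ := exists_lt_of_csInf_lt (upperSet_nonempty hb) ht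
  exact (crossUpper_of_mem hb hs).mono hst.le

theorem crossLower_of_gt {b t : ℝ} (hb : 0 < b) (ht : tTwo b < t) : CrossLower b t := by
  obtain ⟨s, hs, hst⟩ := exists_lt_of_csInf_lt (lowerSet_nonempty hb) ht
  exact (crossLower_of_mem hb hs).mono hst.le

/-- The optimal Chernoff parameter `g` is the ratio of threshold to mean, which the bound on `s`
makes at most `1`. -/
theorem nearExponent_of_rate {a b t s : ℝ} (hb : 0 < b) (ht : 0 ≤ t)
    (h : 1 / 2 * ((4 * b + 2 * t) * Real.log ((4 * b + 2 * t) / (2 * a - s))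
      + 2 * a - s - 4 * b - 2 * t) > 1) (hs : s ≤ 2 * a - 4 * b - 2 * t) :
    NearExponent a b t s := by
  have hl : 0 < 2 * a - s := by linarith
  refine ⟨(4 * b + 2 * t) / (2 * a - s), by positivity, ?_, ?_⟩
  · rw [div_le_one hl]; linarith
  · have : (1 - (4 * b + 2 * t) / (2 * a - s)) * ((2 * a - s) / 2) =
        (2 * a - s - (4 * b + 2 * t)) / 2 := by field_simp
    rw [this]
    linarith

/-- The optimal `g` is again threshold over mean. The lower bound on `s` makes it at least `1`, so
`4 b - 2 t` is positive and the logarithm is evaluated only at positive arguments. -/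
theorem farExponent_of_rate {a b t s : ℝ} (hb : 0 < b) (ha : 2 * b ≤ a)
    (h : 1 / 2 * ((4 * b - 2 * t) * Real.log ((4 * b - 2 * t) / (2 * a - s))
      + 2 * a - s - 4 * b + 2 * t) > 1) (hs : 2 * a - 4 * b + 2 * t ≤ s) (hsa : s ≤ a) :
    FarExponent a b t s := by
  have hl : 0 < 2 * a - s := by linarith
  refine ⟨(4 * b - 2 * t) / (2 * a - s), ?_, ?_⟩
  · rw [one_le_div hl]; linarith
  · have : ((4 * b - 2 * t) / (2 * a - s) - 1) * ((2 * a - s) / 2) =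
        (4 * b - 2 * t - (2 * a - s)) / 2 := by field_simp
    rw [this]
    linarith

/-- Since the logarithm is nonpositive, half the mean term `2 a - s ≤ a` must already exceed `1`.
This serves the case in which `s₁` overshoots `s₂ = a`. -/
theorem two_lt_of_rate {a b t s : ℝ} (hb : 0 < b) (ht : 0 ≤ t)
    (h : 1 / 2 * ((4 * b + 2 * t) * Real.log ((4 * b + 2 * t) / (2 * a - s))
      + 2 * a - s - 4 * b - 2 * t) > 1) (hs : s ≤ 2 * a - 4 * b - 2 * t) (has : a ≤ s) : 2 < a := by
  have hl : 0 < 2 * a - s := by linarith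
  have : Real.log ((4 * b + 2 * t) / (2 * a - s)) ≤ 0 :=
    Real.log_nonpos (by positivity) (by rw [div_le_one hl]; linarith)
  have : (4 * b + 2 * t) * Real.log ((4 * b + 2 * t) / (2 * a - s)) ≤ 0 :=
    mul_nonpos_of_nonneg_of_nonpos (by positivity) this
  linarith

theorem NearExponent.anti {a b t s s' : ℝ} (h : NearExponent a b t s) (hs : s' ≤ s) :
    NearExponent a b t s' := by
  obtain ⟨g, h0, h1, h⟩ := h
  exact ⟨g, h0, h1, by nlinarith⟩

/-- The recovery condition provides distances at which edges are kept. -/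
theorem exists_feasible {a b t₁ t₂ : ℝ} (hb : 0 < b) (hab : 2 * b ≤ a) (ht₁ : 0 ≤ t₁)
    (ht₂ : 0 ≤ t₂) (h : Condition a (thetaOne a b t₁) (thetaTwo a b t₂)) :
    ∃ s₁ s₂, Feasible a b t₁ t₂ s₁ s₂ := by
  have hone : ∀ x < thetaOne a b t₁, ∃ s, x < s ∧ 0 ≤ s ∧
      (s = 0 ∨ NearExponent a b t₁ s ∧ s ≤ 2 * a - 4 * b - 2 * t₁ ∧ (a ≤ s → 2 < a)) := by
    intro x hx
    obtain ⟨s, hs, hxs⟩ := exists_lt_of_lt_csSup (Set.insert_nonempty _ _) hx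
    rcases hs with rfl | ⟨h1, h2, h3⟩
    · exact ⟨0, hxs, le_rfl, Or.inl rfl⟩
    · exact ⟨s, hxs, h2, Or.inr ⟨nearExponent_of_rate hb ht₁ h1 h3, h3,
        two_lt_of_rate hb ht₁ h1 h3⟩⟩
  have htwo : ∀ x > thetaTwo a b t₂, ∃ s, s < x ∧ 2 * b ≤ s ∧ s ≤ a ∧
      (s = a ∨ FarExponent a b t₂ s ∧ 2 * a - 4 * b + 2 * t₂ ≤ s) := by
    intro x hx
    obtain ⟨s, hs, hxs⟩ := exists_lt_of_csInf_lt (Set.insert_nonempty _ _) hx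
    rcases hs with rfl | ⟨h1, h2, h3⟩
    · exact ⟨s, hxs, hab, le_rfl, Or.inl rfl⟩
    · rw [max_le_iff] at h2
      exact ⟨s, hxs, h2.1, h3, Or.inr ⟨farExponent_of_rate hb hab h1 h2.2 h3, h2.2⟩⟩
  rcases h with h | ⟨h, h'⟩
  · obtain ⟨s₁, h1, h2, h3⟩ := hone
      (thetaOne a b t₁ - (a - thetaTwo a b t₂ + thetaOne a b t₁ - 2) / 2) (by linarith)
    obtain ⟨s₂, h4, h5, h6, h7⟩ := htwo
      (thetaTwo a b t₂ + (a - thetaTwo a b t₂ + thetaOne a b t₁ - 2) / 2) (by linarith)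
    have hsum : 2 < a - s₂ + s₁ := by linarith
    by_cases hle : s₁ ≤ s₂
    · exact ⟨s₁, s₂, h2, by linarith, h6, h3.imp_right fun h => h.1,
        h7.imp_right fun h => ⟨h5, h.1⟩, Or.inl ⟨hle, hsum⟩⟩
    · rcases h3 with rfl | ⟨h3, h8, h9⟩
      · linarith
      rcases h7 with rfl | ⟨h7, h10⟩
      -- Here `s₁ > a`, so all edges inside a part are short enough to be kept: lower `s₁` to `a`,
      -- and use `a > 2`.
      · have := h9 (by linarith)
        exact ⟨s₂, s₂, by linarith, by linarith, h6, Or.inr (h3.anti (by linarith)), Or.inl rfl,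
          Or.inl ⟨le_rfl, by linarith⟩⟩
      -- Impossible, since `s₁ ≤ 2 a - 4 b - 2 t₁ ≤ 2 a - 4 b + 2 t₂ ≤ s₂`.
      · linarith
  · obtain ⟨s₂, h4, h5, h6, h7⟩ := htwo
      (thetaTwo a b t₂ + (a - thetaTwo a b t₂ - 1) / 2) (by linarith)
    exact ⟨0, s₂, le_rfl, by linarith, h6, Or.inl rfl, h7.imp_right fun h => ⟨h5, h.1⟩,
      Or.inr ⟨by linarith, h'⟩⟩

theorem NearExponent.eventually {a b t s : ℝ} (h : NearExponent a b t s) :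
    ∀ᶠ t' in 𝓝 t, NearExponent a b t' s := by
  obtain ⟨g, h0, h1, h⟩ := h
  have hc : Continuous fun t' => (1 - g) * ((2 * a - s) / 2) + (2 * b + t') * Real.log g := by
    fun_prop
  filter_upwards [hc.continuousAt.eventually (lt_mem_nhds h)] with t' ht'
  exact ⟨g, h0, h1, ht'⟩

theorem FarExponent.eventually {a b t s : ℝ} (h : FarExponent a b t s) :
    ∀ᶠ t' in 𝓝 t, FarExponent a b t' s := by
  obtain ⟨g, h1, h⟩ := h
  have hc : Continuous fun t' => (2 * b - t') * Real.log g - (g - 1) * ((2 * a - s) / 2) := by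
    fun_prop
  filter_upwards [hc.continuousAt.eventually (lt_mem_nhds h)] with t' ht'
  exact ⟨g, h1, ht'⟩

/-- For a fixed `g` the exponents are continuous in the threshold, so the strict inequalities at the
infima survive a small increase with the same `s₁` and `s₂`. -/
theorem Feasible.exists_pos {a b t₁ t₂ s₁ s₂ : ℝ} (h : Feasible a b t₁ t₂ s₁ s₂) :
    ∃ ε > 0, ∀ t₁' ∈ Set.Ioo t₁ (t₁ + ε), ∀ t₂' ∈ Set.Ioo t₂ (t₂ + ε),
      Feasible a b t₁' t₂' s₁ s₂ := by
  have h1 : ∀ᶠ t in 𝓝 t₁, s₁ = 0 ∨ NearExponent a b t s₁ := by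
    rcases h.near with h | h
    · exact Eventually.of_forall fun _ => Or.inl h
    · exact h.eventually.mono fun _ => Or.inr
  have h2 : ∀ᶠ t in 𝓝 t₂, s₂ = a ∨ (2 * b ≤ s₂ ∧ FarExponent a b t s₂) := by
    rcases h.far with h | h
    · exact Eventually.of_forall fun _ => Or.inl h
    · exact h.2.eventually.mono fun _ h' => Or.inr ⟨h.1, h'⟩
  obtain ⟨ε₁, hε₁, h1⟩ := Metric.eventually_nhds_iff.1 h1
  obtain ⟨ε₂, hε₂, h2⟩ := Metric.eventually_nhds_iff.1 h2
  refine ⟨min ε₁ ε₂, lt_min hε₁ hε₂, fun t₁' ht₁ t₂' ht₂ => ⟨h.nonneg, h.nonneg', h.le, h1 ?_,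
    h2 ?_, h.spread⟩⟩
  · rw [Real.dist_eq, abs_of_pos (by linarith [ht₁.1])]
    linarith [ht₁.2, min_le_left ε₁ ε₂]
  · rw [Real.dist_eq, abs_of_pos (by linarith [ht₂.1])]
    linarith [ht₂.2, min_le_right ε₁ ε₂]

end GBM

namespace GBM

open MeasureTheory

/-! ### The uniform law on the circle -/

/-- The uniform law on `[0,1]`. -/
noncomputable def unif : Measure ℝ := (volume : Measure ℝ).restrict (Set.Icc 0 1)

instance : IsProbabilityMeasure unif := ⟨by
  rw [unif, Measure.restrict_apply_univ, Real.volume_Icc]; norm_num⟩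

theorem locations_eq (n : ℕ) : locations n = Measure.pi fun _ => unif := rfl

instance (n : ℕ) : IsProbabilityMeasure (locations n) := by
  rw [locations_eq]; infer_instance

theorem norm_coe_le_abs (s : ℝ) : ‖(s : UnitAddCircle)‖ ≤ |s| := by
  rw [UnitAddCircle.norm_eq]
  simpa using round_le s 0

theorem exists_abs_eq_norm (c : UnitAddCircle) : ∃ s : ℝ, (s : UnitAddCircle) = c ∧ |s| = ‖c‖ := by
  obtain ⟨t, rfl⟩ := QuotientAddGroup.mk_surjective c
  refine ⟨t - round t, ?_, (UnitAddCircle.norm_eq (x := t)).symm⟩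
  rw [AddCircle.coe_sub, sub_eq_self]
  simp

theorem dL_eq_dist {x y : ℝ} (hx : x ∈ Set.Icc (0 : ℝ) 1) (hy : y ∈ Set.Icc (0 : ℝ) 1) :
    dL x y = dist (x : UnitAddCircle) (y : UnitAddCircle) := by
  have key : ∀ s : ℝ, 0 ≤ s → s ≤ 1 → min s (1 - s) = ‖(s : UnitAddCircle)‖ := by
    intro s h0 h1
    rw [UnitAddCircle.norm_eq, abs_sub_round_eq_min]
    rcases h1.lt_or_eq with h | rfl
    · rw [Int.fract_eq_self.2 ⟨h0, h⟩]
    · simp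
  rw [dist_eq_norm, ← AddCircle.coe_sub, dL, key _ (abs_nonneg _)
    (abs_le.2 ⟨by linarith [hx.1, hy.2], by linarith [hx.2, hy.1]⟩)]
  rcases abs_choice (x - y) with h | h <;> rw [h]
  rw [AddCircle.coe_neg, norm_neg]

theorem dL_comm (x y : ℝ) : dL x y = dL y x := by
  simp only [dL, abs_sub_comm]

theorem dL_triangle {x y z : ℝ} (hx : x ∈ Set.Icc (0 : ℝ) 1) (hy : y ∈ Set.Icc (0 : ℝ) 1)
    (hz : z ∈ Set.Icc (0 : ℝ) 1) : dL x z ≤ dL x y + dL y z := by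
  rw [dL_eq_dist hx hy, dL_eq_dist hy hz, dL_eq_dist hx hz]
  exact dist_triangle _ _ _

theorem measurable_dL : Measurable fun p : ℝ × ℝ => dL p.1 p.2 := by
  unfold dL
  fun_prop

theorem unif_real_preimage {S : Set UnitAddCircle} (hS : MeasurableSet S) :
    unif.real {t : ℝ | (t : UnitAddCircle) ∈ S} = volume.real S := by
  have h := (UnitAddCircle.measurePreserving_mk 0).measure_preimage hS.nullMeasurableSet
  rw [zero_add, Measure.restrict_congr_set Ioc_ae_eq_Icc] at h
  rw [measureReal_def, measureReal_def, ← h]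
  rfl

theorem unif_real_congr {A : Set ℝ} {S : Set UnitAddCircle} (hS : MeasurableSet S)
    (h : ∀ t ∈ Set.Icc (0 : ℝ) 1, (t ∈ A ↔ (t : UnitAddCircle) ∈ S)) :
    unif.real A = volume.real S := by
  rw [← unif_real_preimage hS]
  refine measureReal_congr ?_
  rw [unif, Filter.eventuallyEq_set]
  exact (ae_restrict_iff' measurableSet_Icc).2 (Filter.Eventually.of_forall h)

theorem volume_real_closedBall (c : UnitAddCircle) {r : ℝ} (h0 : 0 ≤ r) (hr : 2 * r ≤ 1) :
    volume.real (Metric.closedBall c r) = 2 * r := by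
  rw [measureReal_def, AddCircle.volume_closedBall, min_eq_right hr,
    ENNReal.toReal_ofReal (by linarith)]

theorem exists_midpoint (x y : UnitAddCircle) : ∃ (c : UnitAddCircle) (s : ℝ), |s| = dist x y / 2 ∧
    x = c + s ∧ y = c - s := by
  obtain ⟨s, hs, hs'⟩ := exists_abs_eq_norm (x - y)
  have hss : ((s / 2 : ℝ) : UnitAddCircle) + ((s / 2 : ℝ) : UnitAddCircle) = x - y := by
    rw [← AddCircle.coe_add, add_halves, hs]
  refine ⟨y + (s / 2 : ℝ), s / 2, ?_, ?_, ?_⟩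
  · rw [abs_div, hs', dist_eq_norm]; norm_num
  · rw [add_assoc, hss]; abel
  · abel

/-- The ball of radius `r - dist x y / 2` about a midpoint lies in both balls. -/
theorem le_volume_inter (x y : UnitAddCircle) {r : ℝ} (hr : 2 * r ≤ 1) :
    2 * r - dist x y ≤ volume.real (Metric.closedBall x r ∩ Metric.closedBall y r) := by
  obtain ⟨c, s, hs, rfl, rfl⟩ := exists_midpoint x y
  rcases le_or_gt 0 (r - |s|) with h0 | h0
  · have h := volume_real_closedBall c h0 (by linarith [abs_nonneg s])
    have : 2 * r - dist (c + s) (c - s) = 2 * (r - |s|) := by rw [hs]; ring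
    rw [this, ← h]
    refine measureReal_mono fun t ht => ?_
    rw [Metric.mem_closedBall, dist_eq_norm] at ht
    have h1 := norm_coe_le_abs s
    constructor <;> rw [Metric.mem_closedBall, dist_eq_norm]
    · calc ‖t - (c + s)‖ = ‖(t - c) - s‖ := by congr 1; abel
        _ ≤ ‖t - c‖ + ‖(s : UnitAddCircle)‖ := norm_sub_le _ _
        _ ≤ r := by linarith
    · calc ‖t - (c - s)‖ = ‖(t - c) + s‖ := by congr 1; abel
        _ ≤ ‖t - c‖ + ‖(s : UnitAddCircle)‖ := norm_add_le _ _
        _ ≤ r := by linarith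
  · refine le_trans ?_ measureReal_nonneg
    linarith

/-- The ball of radius `r + dist x y / 2` about a midpoint is covered by the union;
inclusion-exclusion does the rest. The second hypothesis prevents this ball from wrapping around the
circle. -/
theorem volume_inter_le (x y : UnitAddCircle) {r : ℝ} (hxy : dist x y ≤ 2 * r)
    (hr : 2 * r + dist x y ≤ 1) :
    volume.real (Metric.closedBall x r ∩ Metric.closedBall y r) ≤ 2 * r - dist x y := by
  obtain ⟨c, s, hs, rfl, rfl⟩ := exists_midpoint x y
  have hs0 := abs_nonneg s
  have hr0 : 0 ≤ r := by linarith
  have h := volume_real_closedBall c (r := r + |s|) (by linarith) (by linarith)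
  have hsub : Metric.closedBall c (r + |s|) ⊆
      Metric.closedBall (c + s) r ∪ Metric.closedBall (c - s) r := by
    intro t ht
    rw [Metric.mem_closedBall, dist_eq_norm] at ht
    obtain ⟨u, hu, hu'⟩ := exists_abs_eq_norm (t - c)
    rw [← hu'] at ht
    have hmin : |u - s| ≤ r ∨ |u + s| ≤ r := by
      rcases abs_cases u with ⟨h1, h1'⟩ | ⟨h1, h1'⟩ <;> rcases abs_cases s with ⟨h2, h2'⟩ | ⟨h2, h2'⟩
      · left; rw [abs_le]; constructor <;> linarith
      · right; rw [abs_le]; constructor <;> linarith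
      · right; rw [abs_le]; constructor <;> linarith
      · left; rw [abs_le]; constructor <;> linarith
    rcases hmin with hm | hm
    · left
      rw [Metric.mem_closedBall, dist_eq_norm]
      calc ‖t - (c + s)‖ = ‖(t - c) - s‖ := by congr 1; abel
        _ = ‖((u - s : ℝ) : UnitAddCircle)‖ := by rw [← hu, AddCircle.coe_sub]
        _ ≤ r := (norm_coe_le_abs _).trans hm
    · right
      rw [Metric.mem_closedBall, dist_eq_norm]
      calc ‖t - (c - s)‖ = ‖(t - c) + s‖ := by congr 1; abel
        _ = ‖((u + s : ℝ) : UnitAddCircle)‖ := by rw [← hu, AddCircle.coe_add]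
        _ ≤ r := (norm_coe_le_abs _).trans hm
  have h1 := measureReal_mono (μ := (volume : Measure UnitAddCircle)) hsub
  have h2 := measureReal_union_add_inter (μ := (volume : Measure UnitAddCircle))
    (s := Metric.closedBall (c + s) r) (t := Metric.closedBall (c - s) r)
    Metric.isClosed_closedBall.measurableSet
  have h3 : 2 * r ≤ 1 := by linarith
  rw [volume_real_closedBall _ hr0 h3, volume_real_closedBall _ hr0 h3] at h2
  linarith

theorem unif_inter_eq {x y r r' : ℝ} (hx : x ∈ Set.Icc (0 : ℝ) 1) (hy : y ∈ Set.Icc (0 : ℝ) 1) :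
    unif.real {t | dL t x ≤ r ∧ dL t y ≤ r'} =
      volume.real (Metric.closedBall (x : UnitAddCircle) r ∩
        Metric.closedBall (y : UnitAddCircle) r') := by
  refine unif_real_congr (Metric.isClosed_closedBall.measurableSet.inter
    Metric.isClosed_closedBall.measurableSet) fun t ht => ?_
  rw [Set.mem_ofPred_eq, dL_eq_dist ht hx, dL_eq_dist ht hy]
  rfl

theorem le_unif_inter {x y r : ℝ} (hx : x ∈ Set.Icc (0 : ℝ) 1) (hy : y ∈ Set.Icc (0 : ℝ) 1)
    (hr : 2 * r ≤ 1) : 2 * r - dL x y ≤ unif.real {t | dL t x ≤ r ∧ dL t y ≤ r} := by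
  rw [unif_inter_eq hx hy, dL_eq_dist hx hy]
  exact le_volume_inter _ _ hr

theorem unif_inter_le {x y r : ℝ} (hx : x ∈ Set.Icc (0 : ℝ) 1) (hy : y ∈ Set.Icc (0 : ℝ) 1)
    (hxy : dL x y ≤ 2 * r) (hr : 2 * r + dL x y ≤ 1) :
    unif.real {t | dL t x ≤ r ∧ dL t y ≤ r} ≤ 2 * r - dL x y := by
  rw [dL_eq_dist hx hy] at *
  rw [unif_inter_eq hx hy]
  exact volume_inter_le _ _ hxy hr

theorem unif_inter_eq_zero {x y r : ℝ} (hx : x ∈ Set.Icc (0 : ℝ) 1) (hy : y ∈ Set.Icc (0 : ℝ) 1)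
    (hxy : 2 * r < dL x y) : unif.real {t | dL t x ≤ r ∧ dL t y ≤ r} = 0 := by
  rw [unif_real_congr (S := ∅) .empty, measureReal_empty]
  intro t ht
  simp only [Set.mem_ofPred_eq, Set.mem_empty_iff_false, iff_false]
  rintro ⟨h1, h2⟩
  have := dL_triangle hx ht hy
  rw [dL_comm x t] at this
  linarith

theorem unif_ball {x r : ℝ} (hx : x ∈ Set.Icc (0 : ℝ) 1) (h0 : 0 ≤ r) (hr : 2 * r ≤ 1) :
    unif.real {t | dL t x ≤ r} = 2 * r := by
  rw [← volume_real_closedBall (x : UnitAddCircle) h0 hr]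
  refine unif_real_congr Metric.isClosed_closedBall.measurableSet fun t ht => ?_
  rw [Set.mem_ofPred_eq, dL_eq_dist ht hx]
  rfl

/-- A point within `r` of `y` is within `r'` of `x`. -/
theorem unif_inter_eq_left {x y r r' : ℝ} (hx : x ∈ Set.Icc (0 : ℝ) 1)
    (hy : y ∈ Set.Icc (0 : ℝ) 1) (hxy : dL x y ≤ r) (h0 : 0 ≤ r) (hr : 2 * r ≤ 1)
    (hrr : 2 * r ≤ r') : unif.real {t | dL t x ≤ r ∧ dL t y ≤ r'} = 2 * r := by
  rw [← unif_ball hx h0 hr]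
  refine measureReal_congr ?_
  rw [unif, Filter.eventuallyEq_set]
  refine (ae_restrict_iff' measurableSet_Icc).2 (Filter.Eventually.of_forall fun t ht => ?_)
  refine ⟨fun h => h.1, fun h => ⟨h, ?_⟩⟩
  rw [Set.mem_ofPred_eq] at h
  have := dL_triangle ht hx hy
  linarith

theorem unif_inter_eq_right {x y r r' : ℝ} (hx : x ∈ Set.Icc (0 : ℝ) 1)
    (hy : y ∈ Set.Icc (0 : ℝ) 1) (hxy : dL x y ≤ r) (h0 : 0 ≤ r) (hr : 2 * r ≤ 1)
    (hrr : 2 * r ≤ r') : unif.real {t | dL t x ≤ r' ∧ dL t y ≤ r} = 2 * r := by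
  rw [← unif_inter_eq_left hy hx (by rwa [dL_comm]) h0 hr hrr]
  congr 1
  ext t
  exact and_comm

end GBM

namespace GBM

open MeasureTheory ProbabilityTheory
open scoped ENNReal

/-! ### Tail bounds for counts that depend on two of the points -/

theorem lintegral_pi_prod {ι : Type*} [Fintype ι] {ν : Measure ℝ} [IsProbabilityMeasure ν]
    {h : ι → ℝ → ℝ≥0∞} (hh : ∀ i, Measurable (h i)) :
    ∫⁻ y, ∏ i, h i (y i) ∂(Measure.pi fun _ : ι => ν) = ∏ i, ∫⁻ t, h i t ∂ν := by
  rw [lintegral_prod_eq_prod_lintegral_of_indepFun Finset.univ (fun i (y : ι → ℝ) => h i (y i))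
    (iIndepFun_pi fun i => (hh i).aemeasurable) fun i => (hh i).comp (measurable_pi_apply i)]
  refine Finset.prod_congr rfl fun i _ => ?_
  exact (measurePreserving_eval (fun _ : ι => ν) i).lintegral_comp (hh i)

-- The integral is `1 + (g - 1) ν(A)`, and `1 + q ≤ exp q`.
open Classical in
theorem lintegral_ite_le {ν : Measure ℝ} [IsProbabilityMeasure ν] {A : Set ℝ}
    (hA : MeasurableSet A) {g q : ℝ} (hg : 0 < g) (hq : (g - 1) * ν.real A ≤ q) :
    ∫⁻ t, (if t ∈ A then ENNReal.ofReal g else 1) ∂ν ≤ ENNReal.ofReal (Real.exp q) := by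
  have h1 : ∫⁻ t, (if t ∈ A then ENNReal.ofReal g else 1) ∂ν =
      ENNReal.ofReal g * ν A + ν Aᶜ := by
    have : (fun t => if t ∈ A then ENNReal.ofReal g else 1) =
        A.piecewise (fun _ => ENNReal.ofReal g) (fun _ => (1 : ℝ≥0∞)) := rfl
    rw [this, lintegral_piecewise hA, setLIntegral_const, setLIntegral_const, one_mul]
  have h2 : ENNReal.ofReal g * ν A + ν Aᶜ = ENNReal.ofReal (1 + (g - 1) * ν.real A) := by
    rw [← ofReal_measureReal, ← ofReal_measureReal, ← ENNReal.ofReal_mul hg.le,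
      ← ENNReal.ofReal_add (by positivity) (by positivity), probReal_compl_eq_one_sub hA]
    congr 1
    ring
  rw [h1, h2]
  refine ENNReal.ofReal_le_ofReal ?_
  linarith [Real.add_one_le_exp q]

open Classical in
/-- Chernoff's bound for the number of points in a region that depends on two of the points. -/
theorem measure_pair_tail_le {ι : Type*} [Fintype ι] [DecidableEq ι] {ν : Measure ℝ} [IsProbabilityMeasure ν]
    {u v : ι} (huv : u ≠ v) {B : Set (ℝ × ℝ)} (hB : MeasurableSet B)
    {A : ι → Set ((ℝ × ℝ) × ℝ)} (hA : ∀ z, MeasurableSet (A z)) {g s : ℝ} (hg : 0 < g) {q : ι → ℝ}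
    (hq : ∀ p ∈ B, ∀ z, z ≠ u → z ≠ v → (g - 1) * ν.real {t | (p, t) ∈ A z} ≤ q z) :
    (Measure.pi fun _ : ι => ν) {X | (X u, X v) ∈ B ∧
      s ≤ (({u, v}ᶜ : Finset ι).filter fun z => ((X u, X v), X z) ∈ A z).card * Real.log g} ≤
      ENNReal.ofReal (Real.exp (∑ z ∈ ({u, v}ᶜ : Finset ι), q z - s)) * (ν.prod ν) B := by
  set T : Finset ι := {u, v}ᶜ with hT
  have hTu : u ∉ T := by simp [hT]
  have hTv : v ∉ T := by simp [hT]
  have hTz : ∀ z ∈ T, z ≠ u ∧ z ≠ v := fun z hz => by simpa [hT] using hz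
  set h : ι → (ℝ × ℝ) × ℝ → ℝ≥0∞ := fun z p => if p ∈ A z then ENNReal.ofReal g else 1 with hh
  have hhm : ∀ z, Measurable (h z) := fun z =>
    Measurable.ite (hA z) measurable_const measurable_const
  set ind : ℝ × ℝ → ℝ≥0∞ := B.indicator 1 with hind
  have hindm : Measurable ind := measurable_one.indicator hB
  set F : (ι → ℝ) → ℝ≥0∞ := fun X => ENNReal.ofReal (Real.exp (-s)) *
    (ind (X u, X v) * ∏ z ∈ T, h z ((X u, X v), X z)) with hF
  have hFm : Measurable F := by
    refine measurable_const.mul ((hindm.comp (by fun_prop)).mul ?_)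
    exact Finset.measurable_prod _ fun z _ => (hhm z).comp (by fun_prop)
  -- Markov's inequality for `g ^ count`, restricted to the event that the pair lies in `B`.
  have hmarkov : (Measure.pi fun _ : ι => ν) {X | (X u, X v) ∈ B ∧
      s ≤ (T.filter fun z => ((X u, X v), X z) ∈ A z).card * Real.log g} ≤
      ∫⁻ X, F X ∂(Measure.pi fun _ : ι => ν) := by
    refine meas_le_lintegral₀ hFm.aemeasurable fun X hX => ?_
    obtain ⟨hX1, hX2⟩ := hX
    have hprod : ∏ z ∈ T, h z ((X u, X v), X z) = ENNReal.ofReal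
        (Real.exp ((T.filter fun z => ((X u, X v), X z) ∈ A z).card * Real.log g)) := by
      simp only [hh]
      rw [Finset.prod_ite, Finset.prod_const, Finset.prod_const_one, mul_one,
        ← ENNReal.ofReal_pow hg.le, mul_comm, Real.exp_mul, Real.exp_log hg, Real.rpow_natCast]
    simp only [hF, hind, hprod]
    rw [Set.indicator_of_mem hX1, Pi.one_apply, one_mul, ← ENNReal.ofReal_mul (Real.exp_pos _).le,
      ← Real.exp_add, ← ENNReal.ofReal_one]
    exact ENNReal.ofReal_le_ofReal (Real.one_le_exp (by linarith))
  -- With `X u` and `X v` frozen, the other coordinates are independent and the integral factorizes.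
  have hmarg : ∀ X, (∫⋯∫⁻_T, F ∂fun _ => ν) X ≤
      ENNReal.ofReal (Real.exp (∑ z ∈ T, q z - s)) * ind (X u, X v) := by
    intro X
    rw [lmarginal]
    have hup : ∀ y : T → ℝ, F (Function.updateFinset X T y) =
        ENNReal.ofReal (Real.exp (-s)) * ind (X u, X v) *
          ∏ z : T, h z ((X u, X v), y z) := by
      intro y
      simp only [hF]
      rw [← mul_assoc, ← Finset.prod_coe_sort]
      have e1 : Function.updateFinset X T y u = X u := by simp [Function.updateFinset, hTu]
      have e2 : Function.updateFinset X T y v = X v := by simp [Function.updateFinset, hTv]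
      rw [e1, e2]
      congr 1
      refine Finset.prod_congr rfl fun z _ => ?_
      simp [Function.updateFinset]
    simp only [hup]
    have hmeas : ∀ z : T, Measurable fun t => h z ((X u, X v), t) := fun z =>
      (hhm z).comp (by fun_prop)
    have hpm : Measurable fun y : T → ℝ => ∏ z : T, h z ((X u, X v), y z) :=
      Finset.measurable_prod _ fun z _ => (hmeas z).comp (measurable_pi_apply z)
    rw [lintegral_const_mul _ hpm,
      lintegral_pi_prod (h := fun (z : T) t => h z ((X u, X v), t)) hmeas]
    by_cases hX : (X u, X v) ∈ B
    · have hle : ∏ z : T, ∫⁻ t, h z ((X u, X v), t) ∂ν ≤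
          ∏ z : T, ENNReal.ofReal (Real.exp (q z)) := by
        refine Finset.prod_le_prod' fun z _ => ?_
        exact lintegral_ite_le (A := {t | ((X u, X v), t) ∈ A z})
          (measurable_prodMk_left (hA z)) hg
          (hq _ hX z (hTz z z.2).1 (hTz z z.2).2)
      refine (mul_le_mul_right hle _).trans_eq ?_
      rw [Finset.prod_coe_sort T fun z => ENNReal.ofReal (Real.exp (q z)),
        ← ENNReal.ofReal_prod_of_nonneg fun z _ => (Real.exp_pos _).le, ← Real.exp_sum,
        mul_right_comm, ← ENNReal.ofReal_mul (Real.exp_pos _).le, ← Real.exp_add,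
        neg_add_eq_sub]
    · simp [hind, hX]
  have hmap : ∫⁻ X, ind (X u, X v) ∂(Measure.pi fun _ : ι => ν) = (ν.prod ν) B := by
    have hind : IndepFun (fun X : ι → ℝ => X u) (fun X : ι → ℝ => X v)
        (Measure.pi fun _ : ι => ν) :=
      (iIndepFun_pi (X := fun (_ : ι) (t : ℝ) => t) fun i => aemeasurable_id).indepFun huv
    rw [indepFun_iff_map_prod_eq_prod_map_map (measurable_pi_apply u).aemeasurable
      (measurable_pi_apply v).aemeasurable] at hind
    have eu : (Measure.pi fun _ : ι => ν).map (fun X : ι → ℝ => X u) = ν :=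
      (measurePreserving_eval (fun _ : ι => ν) u).map_eq
    have ev : (Measure.pi fun _ : ι => ν).map (fun X : ι → ℝ => X v) = ν :=
      (measurePreserving_eval (fun _ : ι => ν) v).map_eq
    rw [eu, ev] at hind
    rw [← lintegral_map (f := ind) hindm (by fun_prop), hind, lintegral_indicator_one hB]
  calc _ ≤ ∫⁻ X, F X ∂(Measure.pi fun _ : ι => ν) := hmarkov
    _ ≤ ∫⁻ X, ENNReal.ofReal (Real.exp (∑ z ∈ T, q z - s)) * ind (X u, X v)
        ∂(Measure.pi fun _ : ι => ν) := by
      refine lintegral_le_of_lmarginal_le T hFm (by fun_prop) fun X => ?_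
      refine (hmarg X).trans_eq ?_
      rw [lmarginal]
      have : ∀ y : T → ℝ, ENNReal.ofReal (Real.exp (∑ z ∈ T, q z - s)) *
          ind (Function.updateFinset X T y u, Function.updateFinset X T y v) =
          ENNReal.ofReal (Real.exp (∑ z ∈ T, q z - s)) * ind (X u, X v) := by
        intro y
        have e1 : Function.updateFinset X T y u = X u := by simp [Function.updateFinset, hTu]
        have e2 : Function.updateFinset X T y v = X v := by simp [Function.updateFinset, hTv]
        rw [e1, e2]
      simp only [this]
      rw [lintegral_const, measure_univ, mul_one]
    _ = _ := by rw [lintegral_const_mul _ (by fun_prop), hmap]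

theorem unif_prod_dL_le {r : ℝ} (h0 : 0 ≤ r) (hr : 2 * r ≤ 1) {B : Set (ℝ × ℝ)}
    (hB : ∀ p ∈ B, dL p.1 p.2 ≤ r) : (unif.prod unif) B ≤ ENNReal.ofReal (2 * r) := by
  have hm : MeasurableSet {p : ℝ × ℝ | dL p.1 p.2 ≤ r} :=
    measurableSet_le measurable_dL measurable_const
  refine (measure_mono (show B ⊆ {p : ℝ × ℝ | dL p.1 p.2 ≤ r} from hB)).trans ?_
  rw [Measure.prod_apply hm]
  calc _ ≤ ∫⁻ _, ENNReal.ofReal (2 * r) ∂unif := by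
        refine lintegral_mono_ae ?_
        refine (ae_restrict_iff' measurableSet_Icc).2 (Filter.Eventually.of_forall fun x hx => ?_)
        have : Prod.mk x ⁻¹' {p : ℝ × ℝ | dL p.1 p.2 ≤ r} = {t | dL t x ≤ r} := by
          ext t
          simp [dL_comm]
        rw [this, ← ofReal_measureReal, unif_ball hx h0 hr]
    _ = ENNReal.ofReal (2 * r) := by rw [lintegral_const, measure_univ, mul_one]

end GBM

namespace GBM

open MeasureTheory ProbabilityTheory
open scoped ENNReal

/-! ### Common-neighbour counts in the geometric block model -/

open Classical in
/-- The connection radius of two vertices. -/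
noncomputable def radius {n : ℕ} (V : Finset (Fin n)) (rs rd : ℝ) (u v : Fin n) : ℝ :=
  if (u ∈ V ↔ v ∈ V) then rs else rd

theorem graph_adj {n : ℕ} {V : Finset (Fin n)} {rs rd : ℝ} {X : Fin n → ℝ} {u v : Fin n} :
    (graph V rs rd X).Adj u v ↔ u ≠ v ∧ dL (X u) (X v) ≤ radius V rs rd u v := by
  simp only [graph, radius]
  by_cases h : (u ∈ V ↔ v ∈ V) <;> simp [h]

/-- Where `z` has to be, relative to `u` and `v`, in order to be a common neighbour. -/
def region {n : ℕ} (V : Finset (Fin n)) (rs rd : ℝ) (u v z : Fin n) : Set ((ℝ × ℝ) × ℝ) :=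
  {p | dL p.2 p.1.1 ≤ radius V rs rd z u ∧ dL p.2 p.1.2 ≤ radius V rs rd z v}

theorem measurableSet_region {n : ℕ} (V : Finset (Fin n)) (rs rd : ℝ) (u v z : Fin n) :
    MeasurableSet (region V rs rd u v z) :=
  (measurableSet_le (measurable_dL.comp (f := fun p : (ℝ × ℝ) × ℝ => (p.2, p.1.1)) (by fun_prop))
    measurable_const).inter
  (measurableSet_le (measurable_dL.comp (f := fun p : (ℝ × ℝ) × ℝ => (p.2, p.1.2)) (by fun_prop))
    measurable_const)

open Classical in
theorem commonCount_graph_val {n : ℕ} (V : Finset (Fin n)) (rs rd : ℝ) (X : Fin n → ℝ)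
    (u v : Fin n) : (commonCount (graph V rs rd X) u v).val =
      (({u, v}ᶜ : Finset (Fin n)).filter
        fun z => ((X u, X v), X z) ∈ region V rs rd u v z).card := by
  rw [commonCount_val]
  congr 1
  ext z
  rw [Finset.mem_filter, Finset.mem_filter, Finset.mem_compl, Finset.mem_insert,
    Finset.mem_singleton, graph_adj, graph_adj]
  simp only [Finset.mem_univ, true_and, region, not_or, Set.mem_ofPred_eq]
  tauto

-- Multiplying the comparison by `log g` covers both tails: the upper one for `g ≥ 1`, the lower one
-- for `g ≤ 1`. The factor `2 r` is what allows exponents barely above `1` in the union bound.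
open Classical in
theorem pair_count_tail {n : ℕ} (V : Finset (Fin n)) (rs rd : ℝ) {u v : Fin n} (huv : u ≠ v)
    {r : ℝ} (h0 : 0 ≤ r) (hr : 2 * r ≤ 1) {B : Set (ℝ × ℝ)} (hB : MeasurableSet B)
    (hBr : ∀ p ∈ B, dL p.1 p.2 ≤ r) {g c : ℝ} (hg : 0 < g) {q : Fin n → ℝ}
    (hq : ∀ p ∈ B, ∀ z, z ≠ u → z ≠ v →
      (g - 1) * unif.real {t | (p, t) ∈ region V rs rd u v z} ≤ q z) {E : ℝ}
    (hE : ∑ z ∈ ({u, v}ᶜ : Finset (Fin n)), q z - c * Real.log g ≤ E) :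
    locations n {X | (X u, X v) ∈ B ∧
      c * Real.log g ≤ (commonCount (graph V rs rd X) u v).val * Real.log g} ≤
      ENNReal.ofReal (Real.exp E * (2 * r)) := by
  simp only [commonCount_graph_val]
  rw [ENNReal.ofReal_mul (Real.exp_pos _).le]
  refine (measure_pair_tail_le huv hB (measurableSet_region V rs rd u v) hg hq).trans ?_
  gcongr
  exact unif_prod_dL_le h0 hr hBr

theorem card_compl_pair {n : ℕ} {u v : Fin n} (huv : u ≠ v) :
    ((({u, v}ᶜ : Finset (Fin n)).card : ℕ) : ℝ) = n - 2 := by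
  have h := Finset.card_add_card_compl ({u, v} : Finset (Fin n))
  rw [Finset.card_pair huv, Fintype.card_fin] at h
  have : ((2 + ({u, v}ᶜ : Finset (Fin n)).card : ℕ) : ℝ) = n := by rw [h]
  push_cast at this
  linarith

open Classical in
theorem sum_same_part {m : ℕ} {V : Finset (Fin (2 * m))} (hV : V.card = m) {u v : Fin (2 * m)}
    (huv : u ≠ v) (hs : u ∈ V ↔ v ∈ V) (κ : ℝ) :
    ∑ z ∈ ({u, v}ᶜ : Finset (Fin (2 * m))), (if (z ∈ V ↔ u ∈ V) then κ else 0) = (m - 2) * κ := by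
  have hcard : (Finset.univ.filter fun z => (z ∈ V ↔ u ∈ V)).card = m := by
    by_cases hu : u ∈ V
    · simp only [hu, iff_true]
      have : Finset.univ.filter (fun z => z ∈ V) = V := by
        ext z
        simp
      rw [this, hV]
    · simp only [hu, iff_false]
      have h := Finset.card_add_card_compl V
      rw [hV, Fintype.card_fin] at h
      have : Finset.univ.filter (fun z => z ∉ V) = Vᶜ := by
        ext z
        simp
      rw [this]
      omega
  have h1 := Finset.sum_add_sum_compl ({u, v} : Finset (Fin (2 * m)))
    fun z => if (z ∈ V ↔ u ∈ V) then κ else 0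
  have h2 : ∑ z, (if (z ∈ V ↔ u ∈ V) then κ else 0) = m * κ := by
    rw [← Finset.sum_filter, Finset.sum_const, hcard, nsmul_eq_mul]
  rw [Finset.sum_pair huv, h2, if_pos Iff.rfl, if_pos hs.symm] at h1
  linarith

section

variable {a b L : ℝ} (hb : 0 < b) (hab : 2 * b ≤ a) (hL : 0 < L) (haL : 3 * (a * L) ≤ 1)

include hb hab hL haL

/-- Whichever part `z` is in, it must be within `b L` of one endpoint, hence within `2 b L ≤ a L` of
the other. -/
theorem unif_real_region_cross {n : ℕ} (V : Finset (Fin n)) {u v z : Fin n}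
    (hs : ¬ (u ∈ V ↔ v ∈ V)) {p : ℝ × ℝ} (hp : p.1 ∈ Set.Icc (0 : ℝ) 1 ∧ p.2 ∈ Set.Icc (0 : ℝ) 1)
    (hd : dL p.1 p.2 ≤ b * L) :
    unif.real {t | (p, t) ∈ region V (a * L) (b * L) u v z} = 2 * (b * L) := by
  have hbL : 0 < b * L := mul_pos hb hL
  have habL : 2 * (b * L) ≤ a * L := by nlinarith
  simp only [region, Set.mem_ofPred_eq]
  by_cases hz : (z ∈ V ↔ u ∈ V)
  · have hz' : ¬ (z ∈ V ↔ v ∈ V) := by tauto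
    simp only [radius, if_pos hz, if_neg hz']
    exact unif_inter_eq_right hp.1 hp.2 hd hbL.le (by linarith) habL
  · have hz' : (z ∈ V ↔ v ∈ V) := by tauto
    simp only [radius, if_neg hz, if_pos hz']
    exact unif_inter_eq_left hp.1 hp.2 hd hbL.le (by linarith) habL

/-- The locations of two vertices at distance at most `r`. -/
def closePairs (r : ℝ) : Set (ℝ × ℝ) :=
  {p | (p.1 ∈ Set.Icc (0 : ℝ) 1 ∧ p.2 ∈ Set.Icc (0 : ℝ) 1) ∧ dL p.1 p.2 ≤ r}

omit hb hab hL haL in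
theorem measurableSet_closePairs (r : ℝ) : MeasurableSet (closePairs r) :=
  ((measurableSet_Icc.preimage measurable_fst).inter
    (measurableSet_Icc.preimage measurable_snd)).inter
    (measurableSet_le measurable_dL measurable_const)

theorem cross_upper_tail {n : ℕ} (V : Finset (Fin n)) {u v : Fin n} (huv : u ≠ v)
    (hs : ¬ (u ∈ V ↔ v ∈ V)) {g t : ℝ} (hg : 1 < g) :
    locations n {X | (X u, X v) ∈ closePairs (b * L) ∧
      (2 * b + t) * (n * L) ≤ (commonCount (graph V (a * L) (b * L) X) u v).val} ≤
      ENNReal.ofReal (Real.exp (-((2 * b + t) * Real.log g - (g - 1) * (2 * b)) * (n * L)) *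
        (2 * (a * L))) := by
  have hbL : 0 < b * L := mul_pos hb hL
  have habL : 2 * (b * L) ≤ a * L := by nlinarith
  refine le_trans (measure_mono ?_) (pair_count_tail V (a * L) (b * L) huv (r := a * L)
    (c := (2 * b + t) * (n * L)) (g := g) (q := fun _ => (g - 1) * (2 * (b * L)))
    (by linarith) (by linarith) (measurableSet_closePairs (b * L)) (fun p hp => ?_)
    (by linarith) (fun p hp z _ _ => ?_) ?_)
  · rintro X ⟨h1, h2⟩
    exact ⟨h1, mul_le_mul_of_nonneg_right h2 (Real.log_pos hg).le⟩
  · exact hp.2.trans (by linarith)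
  · rw [unif_real_region_cross hb hab hL haL V hs hp.1 hp.2]
  · rw [Finset.sum_const, nsmul_eq_mul, card_compl_pair huv]
    have : 0 < (g - 1) * (b * L) := mul_pos (by linarith) hbL
    nlinarith

theorem cross_lower_tail {n : ℕ} (V : Finset (Fin n)) {u v : Fin n} (huv : u ≠ v)
    (hs : ¬ (u ∈ V ↔ v ∈ V)) {g t : ℝ} (hg : 0 < g) (hg1 : g < 1) (hL1 : L ≤ 1) :
    locations n {X | (X u, X v) ∈ closePairs (b * L) ∧
      (commonCount (graph V (a * L) (b * L) X) u v).val ≤ (2 * b - t) * (n * L)} ≤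
      ENNReal.ofReal (Real.exp (4 * b - ((1 - g) * (2 * b) + (2 * b - t) * Real.log g) * (n * L)) *
        (2 * (a * L))) := by
  have hbL : 0 < b * L := mul_pos hb hL
  have habL : 2 * (b * L) ≤ a * L := by nlinarith
  refine le_trans (measure_mono ?_) (pair_count_tail V (a * L) (b * L) huv (r := a * L)
    (c := (2 * b - t) * (n * L)) (g := g) (q := fun _ => (g - 1) * (2 * (b * L)))
    (by linarith) (by linarith) (measurableSet_closePairs (b * L)) (fun p hp => ?_)
    hg (fun p hp z _ _ => ?_) ?_)
  · rintro X ⟨h1, h2⟩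
    exact ⟨h1, mul_le_mul_of_nonpos_right h2 (Real.log_neg hg hg1).le⟩
  · exact hp.2.trans (by linarith)
  · rw [unif_real_region_cross hb hab hL haL V hs hp.1 hp.2]
  · rw [Finset.sum_const, nsmul_eq_mul, card_compl_pair huv]
    -- There are only `n - 2` other vertices; the two missing terms cost at most the factor `exp (4
    -- b)`.
    have h1 : (1 - g) * (b * L) ≤ b * L := by nlinarith
    have h2 : b * L ≤ b := by nlinarith
    linarith

theorem near_tail {m : ℕ} {V : Finset (Fin (2 * m))} (hV : V.card = m) {u v : Fin (2 * m)}
    (huv : u ≠ v) (hs : u ∈ V ↔ v ∈ V) {g t s : ℝ} (hg : 0 < g) (hg1 : g ≤ 1) (hL1 : L ≤ 1)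
    (hs0 : 0 ≤ s) :
    locations (2 * m) {X | (X u, X v) ∈ closePairs (a * L) ∩ {p | dL p.1 p.2 < s * L} ∧
      (commonCount (graph V (a * L) (b * L) X) u v).val ≤ (2 * b + t) * ((2 * m : ℕ) * L)} ≤
      ENNReal.ofReal (Real.exp (4 * a -
        ((1 - g) * ((2 * a - s) / 2) + (2 * b + t) * Real.log g) * ((2 * m : ℕ) * L)) *
        (2 * (a * L))) := by
  classical
  have haL0 : 0 < a * L := mul_pos (by linarith) hL
  refine le_trans (measure_mono ?_) (pair_count_tail V (a * L) (b * L) huv (r := a * L)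
    (B := closePairs (a * L) ∩ {p | dL p.1 p.2 < s * L})
    (c := (2 * b + t) * ((2 * m : ℕ) * L)) (g := g)
    (q := fun z => if (z ∈ V ↔ u ∈ V) then (g - 1) * ((2 * a - s) * L) else 0)
    (by linarith) (by linarith) ((measurableSet_closePairs (a * L)).inter
      (measurableSet_lt measurable_dL measurable_const)) (fun p hp => ?_)
    hg (fun p hp z _ _ => ?_) ?_)
  · rintro X ⟨h1, h2⟩
    exact ⟨h1, mul_le_mul_of_nonpos_right h2 (Real.log_nonpos hg.le hg1)⟩
  · exact hp.1.2
  · obtain ⟨⟨hp1, hp2⟩, hp3⟩ := hp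
    simp only [Set.mem_ofPred_eq] at hp3
    have hg1' : g - 1 ≤ 0 := by linarith
    split_ifs with hz
    · have hz' : (z ∈ V ↔ v ∈ V) := hz.trans hs
      refine mul_le_mul_of_nonpos_left ?_ hg1'
      simp only [region, Set.mem_ofPred_eq, radius, if_pos hz, if_pos hz']
      refine le_trans ?_ (le_unif_inter hp1.1 hp1.2 (by linarith))
      linarith
    -- Vertices of the other part can only increase the count and are ignored.
    · exact mul_nonpos_of_nonpos_of_nonneg hg1' measureReal_nonneg
  · rw [sum_same_part hV huv hs]
    push_cast
    have h1 : (1 - g) * ((2 * a - s) * L) ≤ 2 * a := by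
      have : (1 - g) * L ≤ 1 := by nlinarith
      have : 0 ≤ (1 - g) * L := mul_nonneg (by linarith) hL.le
      nlinarith
    linarith

theorem far_tail {m : ℕ} {V : Finset (Fin (2 * m))} (hV : V.card = m) {u v : Fin (2 * m)}
    (huv : u ≠ v) (hs : u ∈ V ↔ v ∈ V) {g t s : ℝ} (hg1 : 1 ≤ g) (hsb : 2 * b ≤ s) (hsa : s ≤ a) :
    locations (2 * m) {X | (X u, X v) ∈ closePairs (a * L) ∩ {p | s * L < dL p.1 p.2} ∧
      (2 * b - t) * ((2 * m : ℕ) * L) ≤ (commonCount (graph V (a * L) (b * L) X) u v).val} ≤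
      ENNReal.ofReal (Real.exp (-
        ((2 * b - t) * Real.log g - (g - 1) * ((2 * a - s) / 2)) * ((2 * m : ℕ) * L)) *
        (2 * (a * L))) := by
  classical
  have haL0 : 0 < a * L := mul_pos (by linarith) hL
  refine le_trans (measure_mono ?_) (pair_count_tail V (a * L) (b * L) huv (r := a * L)
    (B := closePairs (a * L) ∩ {p | s * L < dL p.1 p.2})
    (c := (2 * b - t) * ((2 * m : ℕ) * L)) (g := g)
    (q := fun z => if (z ∈ V ↔ u ∈ V) then (g - 1) * ((2 * a - s) * L) else 0)
    (by linarith) (by linarith) ((measurableSet_closePairs (a * L)).inter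
      (measurableSet_lt measurable_const measurable_dL)) (fun p hp => ?_)
    (by linarith) (fun p hp z _ _ => ?_) ?_)
  · rintro X ⟨h1, h2⟩
    exact ⟨h1, mul_le_mul_of_nonneg_right h2 (Real.log_nonneg hg1)⟩
  · exact hp.1.2
  · obtain ⟨⟨hp1, hp2⟩, hp3⟩ := hp
    simp only [Set.mem_ofPred_eq] at hp3
    have hg1' : 0 ≤ g - 1 := by linarith
    split_ifs with hz
    · have hz' : (z ∈ V ↔ v ∈ V) := hz.trans hs
      refine mul_le_mul_of_nonneg_left ?_ hg1'
      simp only [region, Set.mem_ofPred_eq, radius, if_pos hz, if_pos hz']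
      refine (unif_inter_le hp1.1 hp1.2 (by linarith) (by linarith)).trans ?_
      linarith
    · have hz' : ¬ (z ∈ V ↔ v ∈ V) := fun h => hz (h.trans hs.symm)
      simp only [region, Set.mem_ofPred_eq, radius, if_neg hz, if_neg hz']
      -- A vertex of the other part would be within `b L` of both endpoints, whose distance exceeds
      -- `s L ≥ 2 b L`.
      rw [unif_inter_eq_zero hp1.1 hp1.2 (by nlinarith), mul_zero]
  · rw [sum_same_part hV huv hs]
    push_cast
    have h1 : 0 ≤ (g - 1) * ((2 * a - s) * L) :=
      mul_nonneg (by linarith) (mul_nonneg (by linarith) hL.le)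
    linarith

end

end GBM

namespace GBM

/-! ### From cells to points -/

/-- The cells, of side `1 / N` and numbered modulo `N`, that contain a point of the part `V`. -/
def cells {n : ℕ} (V : Finset (Fin n)) (N : ℕ) (X : Fin n → ℝ) : Set ℤ :=
  {i | ∃ u ∈ V, i ≡ ⌊N * X u⌋ [ZMOD N]}

theorem dL_of_cells {N : ℕ} {x y : ℝ} (hx : x ∈ Set.Icc (0 : ℝ) 1) (hy : y ∈ Set.Icc (0 : ℝ) 1)
    {i j : ℤ} (hi : i ≡ ⌊N * x⌋ [ZMOD N]) (hj : j ≡ ⌊N * y⌋ [ZMOD N]) (h1 : 1 ≤ j - i)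
    (h2 : 2 * (j - i + 1) ≤ N) :
    ((j - i : ℤ) - 1 : ℝ) / N < dL x y ∧ dL x y < ((j - i : ℤ) + 1 : ℝ) / N := by
  obtain ⟨c, hc⟩ := hi.dvd
  obtain ⟨d, hd⟩ := hj.dvd
  have hN : (0 : ℝ) < N := by
    have : (0 : ℤ) < N := by omega
    exact_mod_cast this
  -- The representative of `y - x` modulo `1` that matches the lifted cell numbers `i` and `j`.
  set s : ℝ := y - x + (c - d : ℤ) with hs
  have hsN : s * N = N * y - ⌊N * y⌋ - (N * x - ⌊N * x⌋) + (j - i : ℤ) := by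
    have hc' : (⌊N * x⌋ : ℝ) - i = N * c := by exact_mod_cast hc
    have hd' : (⌊N * y⌋ : ℝ) - j = N * d := by exact_mod_cast hd
    rw [hs]
    push_cast
    linear_combination hd' - hc'
  have hy0 := Int.floor_le (N * y)
  have hy1 := Int.lt_floor_add_one (N * y)
  have hx0 := Int.floor_le (N * x)
  have hx1 := Int.lt_floor_add_one (N * x)
  have hs1 : ((j - i : ℤ) - 1 : ℝ) / N < s := by
    rw [div_lt_iff₀ hN, hsN]; linarith
  have hs2 : s < ((j - i : ℤ) + 1 : ℝ) / N := by
    rw [lt_div_iff₀ hN, hsN]; linarith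
  have h1' : (1 : ℝ) ≤ (j - i : ℤ) := by exact_mod_cast h1
  have h2' : 2 * (((j - i : ℤ) : ℝ) + 1) ≤ N := by exact_mod_cast h2
  have hs0 : 0 ≤ s := (div_nonneg (by linarith) hN.le).trans hs1.le
  have hs3 : ((j - i : ℤ) + 1 : ℝ) / N ≤ 1 / 2 := by
    rw [div_le_iff₀ hN]; linarith
  have hdist : dL x y = s := by
    rw [dL_comm, dL_eq_dist hy hx, dist_eq_norm, ← AddCircle.coe_sub]
    have : ((y - x : ℝ) : UnitAddCircle) = (s : UnitAddCircle) := by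
      rw [hs, AddCircle.coe_add, left_eq_add]
      exact (AddCircle.coe_eq_zero_iff (1 : ℝ)).2 ⟨c - d, by simp⟩
    rw [this, (AddCircle.norm_coe_eq_abs_iff (1 : ℝ) one_ne_zero).2, abs_of_nonneg hs0]
    rw [abs_of_nonneg hs0, abs_one]
    linarith
  rw [hdist]
  exact ⟨hs1, hs2⟩

theorem exists_nat_mul_gt {δ : ℝ} (hδ : 0 < δ) (C : ℝ) : ∃ K₀ : ℕ, ∀ K : ℕ, K₀ ≤ K → C ≤ δ * K := by
  obtain ⟨K₀, hK₀⟩ := exists_nat_ge (C / δ)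
  refine ⟨K₀, fun K hK => ?_⟩
  rw [div_le_iff₀ hδ] at hK₀
  have : (K₀ : ℝ) ≤ K := by exact_mod_cast hK
  nlinarith

/-- If the cells have few gaps, then the points of a part are connected through pairs at normalized
distance below `s₁` or between `s₂` and `a`. -/
theorem exists_discretization {a s₁ s₂ : ℝ} (ha : 0 < a) (h₁ : 0 ≤ s₁) (h₂ : 0 ≤ s₂) (h₂a : s₂ ≤ a)
    (hs : Spread a s₁ s₂) :
    ∃ K k M : ℕ, 0 < K ∧ 2 * K < k ∧ ∀ (n N : ℕ) (V : Finset (Fin n)) (X : Fin n → ℝ) (L : ℝ)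
      (r : Setoid (Fin n)), K ≤ N * L → N * L ≤ K + 1 → M ≤ N →
      (∀ u, X u ∈ Set.Icc (0 : ℝ) 1) → FewGaps (cells V N X) M k →
      (∀ u ∈ V, ∀ v ∈ V, u ≠ v → dL (X u) (X v) < s₁ * L → dL (X u) (X v) ≤ a * L → r u v) →
      (∀ u ∈ V, ∀ v ∈ V, u ≠ v → s₂ * L < dL (X u) (X v) → dL (X u) (X v) ≤ a * L → r u v) →
      ∀ u ∈ V, ∀ v ∈ V, r u v := by
  -- `K` is so large that the strict slack in `Spread` absorbs the rounding of `p₁`, `p₂`, `q`; the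
  -- extra `s₂` pays for `K + 1` in place of `K` in `p₂`.
  obtain ⟨K, hK0, hK⟩ : ∃ K : ℕ, 0 < K ∧ ((s₁ ≤ s₂ ∧ 10 + s₂ ≤ (a - s₂ + s₁ - 2) * K) ∨
      (10 + s₂ ≤ (a - s₂ - 1) * K ∧ 10 ≤ (a - 2) * K)) := by
    rcases hs with ⟨h, h'⟩ | ⟨h, h'⟩
    · obtain ⟨K₀, hK₀⟩ := exists_nat_mul_gt (sub_pos.2 h') (10 + s₂)
      exact ⟨K₀ + 1, by omega, Or.inl ⟨h, hK₀ _ (by omega)⟩⟩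
    · obtain ⟨K₀, hK₀⟩ := exists_nat_mul_gt (sub_pos.2 h) (10 + s₂)
      obtain ⟨K₁, hK₁⟩ := exists_nat_mul_gt (sub_pos.2 h') 10
      exact ⟨K₀ + K₁ + 1, by omega, Or.inr ⟨hK₀ _ (by omega), hK₁ _ (by omega)⟩⟩
  have hKpos : (0 : ℝ) < K := by exact_mod_cast hK0
  -- Differences up to `p₁` guarantee distance below `s₁ L`, those from `p₂` on distance above `s₂
  -- L`, those up to `q` distance at most `a L`. As `K ≤ N L ≤ K + 1`, upper bounds on distances use
  -- `K` and lower bounds use `K + 1`.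
  obtain ⟨p₁, hp₁⟩ : ∃ p₁ : ℤ, p₁ = ⌊s₁ * K⌋ - 1 := ⟨_, rfl⟩
  obtain ⟨p₂, hp₂⟩ : ∃ p₂ : ℤ, p₂ = ⌈s₂ * (K + 1)⌉ + 1 := ⟨_, rfl⟩
  obtain ⟨q, hq⟩ : ∃ q : ℤ, q = ⌊a * K⌋ - 1 := ⟨_, rfl⟩
  have hp₁' : (p₁ : ℝ) ≤ s₁ * K - 1 ∧ s₁ * K - 2 ≤ p₁ := by
    rw [hp₁]
    push_cast
    constructor <;> linarith [Int.floor_le (s₁ * K), Int.lt_floor_add_one (s₁ * K)]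
  have hp₂' : s₂ * (K + 1) + 1 ≤ (p₂ : ℝ) ∧ (p₂ : ℝ) ≤ s₂ * (K + 1) + 2 := by
    rw [hp₂]
    push_cast
    constructor <;> linarith [Int.le_ceil (s₂ * (K + 1)), Int.ceil_lt_add_one (s₂ * (K + 1))]
  have hq' : (q : ℝ) ≤ a * K - 1 ∧ a * K - 2 ≤ q := by
    rw [hq]
    push_cast
    constructor <;> linarith [Int.floor_le (a * K), Int.lt_floor_add_one (a * K)]
  have hp₂1 : 1 ≤ p₂ := by
    have : (1 : ℝ) ≤ p₂ := by nlinarith [hp₂'.1]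
    exact_mod_cast this
  have hq0 : 2 * (K : ℤ) + 1 ≤ q := by
    have : 2 * (K : ℝ) + 1 ≤ q := by
      rcases hK with ⟨h, h'⟩ | ⟨-, h'⟩
      · nlinarith [hq'.2]
      · nlinarith [hq'.2]
    exact_mod_cast this
  refine ⟨K, 2 * K + 1, 2 * ((2 * K + 1) * (2 * q + 2)).toNat, hK0, by omega, ?_⟩
  intro n N V X L r hNL hNL' hMN hX hgaps hnear hfar u hu v hv
  have hM : ((2 * ((2 * K + 1) * (2 * q + 2)).toNat : ℕ) : ℤ) =
      2 * ((2 * K + 1 : ℕ) * (2 * q + 2)) := by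
    have h0 : (0 : ℤ) ≤ (2 * K + 1) * (2 * q + 2) := mul_nonneg (by omega) (by omega)
    push_cast
    rw [Int.toNat_of_nonneg h0]
  have hMN' : 2 * (q + 1) ≤ (N : ℤ) := by
    have : ((2 * ((2 * K + 1) * (2 * q + 2)).toNat : ℕ) : ℤ) ≤ N := by exact_mod_cast hMN
    rw [hM] at this
    push_cast at this
    nlinarith
  have hN : (0 : ℝ) < N := by
    have : (0 : ℤ) < N := by omega
    exact_mod_cast this
  rw [hM] at hgaps
  -- Vacuous when a cell is empty, so transitivity holds only through an occupied middle cell.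
  set R : ℤ → ℤ → Prop := fun i j => ∀ u ∈ V, ∀ v ∈ V, i ≡ ⌊N * X u⌋ [ZMOD N] →
    j ≡ ⌊N * X v⌋ [ZMOD N] → r u v with hR
  have hsymm : ∀ i j, R i j → R j i := fun i j h u hu v hv hi hj => r.symm (h v hv u hu hj hi)
  have htrans : ∀ i j k, j ∈ cells V N X → R i j → R j k → R i k := by
    rintro i j k ⟨w, hw, hjw⟩ h h' u hu v hv hi hk
    exact r.trans (h u hu w hw hi hjw) (h' w hw v hv hjw hk)
  have hlocal : ∀ i j : ℤ, 1 ≤ j - i → j - i ≤ q → ∀ u ∈ V, ∀ v ∈ V, i ≡ ⌊N * X u⌋ [ZMOD N] →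
      j ≡ ⌊N * X v⌋ [ZMOD N] → u ≠ v ∧ dL (X u) (X v) ≤ a * L := by
    intro i j h1 h2 u hu v hv hi hj
    obtain ⟨h3, h4⟩ := dL_of_cells (hX u) (hX v) hi hj h1 (by omega)
    have h1' : (1 : ℝ) ≤ (j - i : ℤ) := by exact_mod_cast h1
    have h2' : ((j - i : ℤ) : ℝ) ≤ q := by exact_mod_cast h2
    constructor
    · rintro rfl
      have : 0 ≤ ((j - i : ℤ) - 1 : ℝ) / N := div_nonneg (by linarith) hN.le
      simp only [dL, sub_self, abs_zero, sub_zero] at h3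
      have h0 : min (0 : ℝ) 1 = 0 := min_eq_left zero_le_one
      linarith
    · refine h4.le.trans ?_
      rw [div_le_iff₀ hN]
      nlinarith [hq'.1]
  have hRnear : ∀ i j, 1 ≤ j - i → j - i ≤ q → j - i ≤ p₁ → R i j := by
    intro i j h1 h2 h3 u hu v hv hi hj
    obtain ⟨h4, h5⟩ := hlocal i j h1 h2 u hu v hv hi hj
    refine hnear u hu v hv h4 ?_ h5
    refine (dL_of_cells (hX u) (hX v) hi hj h1 (by omega)).2.trans_le ?_
    have h3' : ((j - i : ℤ) : ℝ) ≤ p₁ := by exact_mod_cast h3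
    rw [div_le_iff₀ hN]
    nlinarith [hp₁'.1]
  have hRfar : ∀ i j, p₂ ≤ j - i → j - i ≤ q → R i j := by
    intro i j h1 h2 u hu v hv hi hj
    obtain ⟨h4, h5⟩ := hlocal i j (by omega) h2 u hu v hv hi hj
    refine hfar u hu v hv h4 ?_ h5
    refine lt_of_le_of_lt ?_ (dL_of_cells (hX u) (hX v) hi hj (by omega) (by omega)).1
    have h1' : (p₂ : ℝ) ≤ (j - i : ℤ) := by exact_mod_cast h1
    rw [le_div_iff₀ hN]
    nlinarith [hp₂'.1]
  have hmem : ∀ u ∈ V, ⌊N * X u⌋ ∈ cells V N X := fun u hu => ⟨u, hu, rfl⟩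
  refine (?_ : R ⌊N * X u⌋ ⌊N * X v⌋) u hu v hv rfl rfl
  rcases hK with ⟨h, h'⟩ | ⟨h, h'⟩
  · have hpp : p₁ < p₂ := by
      have : (p₁ : ℝ) < p₂ := by nlinarith [hp₁'.1, hp₂'.1]
      exact_mod_cast this
    have hpq : p₁ ≤ q := by
      have hlt : (p₁ : ℝ) < q + 1 := by
        rw [hp₁, hq]
        have : ⌊s₁ * K⌋ ≤ ⌊a * K⌋ := Int.floor_le_floor (by nlinarith)
        have : (⌊s₁ * K⌋ : ℝ) ≤ ⌊a * K⌋ := by exact_mod_cast this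
        push_cast
        linarith
      have : p₁ < q + 1 := by exact_mod_cast hlt
      omega
    have hsum : 2 * (K : ℤ) + 1 ≤ p₁ + (q - p₂ + 1) := by
      have : 2 * (K : ℝ) + 1 ≤ p₁ + (q - p₂ + 1) := by nlinarith [hp₁'.2, hp₂'.2, hq'.2]
      exact_mod_cast this
    obtain ⟨D, hD⟩ : ∃ D : Finset ℤ, D = Finset.Icc 1 p₁ ∪ Finset.Icc p₂ q := ⟨_, rfl⟩
    have hmemD : ∀ d, d ∈ D ↔ 1 ≤ d ∧ d ≤ p₁ ∨ p₂ ≤ d ∧ d ≤ q := fun d => by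
      rw [hD, Finset.mem_union, Finset.mem_Icc, Finset.mem_Icc]
    have hcard : 2 * K + 1 ≤ D.card := by
      rw [hD, Finset.card_union_of_disjoint, Int.card_Icc, Int.card_Icc]
      · omega
      · rw [Finset.disjoint_left]
        intro i hi hi'
        rw [Finset.mem_Icc] at hi hi'
        omega
    -- If `p₁ ≤ 1`, the upper interval has at least `2 K` elements, hence two consecutive ones.
    obtain ⟨e, he, he'⟩ : ∃ e, e ∈ D ∧ e + 1 ∈ D := by
      by_cases h : 2 ≤ p₁
      · exact ⟨1, (hmemD _).2 (by omega), (hmemD _).2 (by omega)⟩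
      · exact ⟨p₂, (hmemD _).2 (by omega), (hmemD _).2 (by omega)⟩
    refine related_of_steps hsymm htrans hgaps (D := D) (Q := q) (e := e)
      (fun d hd => ?_) (by omega) hcard he he' ?_ (fun i j hi hj hd => ?_) (hmem u hu) (hmem v hv)
    · rw [hmemD] at hd
      omega
    · have : (0 : ℤ) ≤ (2 * K + 1 : ℕ) * (2 * q + 2) :=
        mul_nonneg (by omega) (by omega)
      omega
    · rw [hmemD] at hd
      rcases hd with hd | hd
      · exact hRnear i j hd.1 (by omega) hd.2
      · exact hRfar i j hd.1 hd.2
  · have hsum : 2 * (K : ℤ) + 1 ≤ 2 * (q - p₂ + 1) := by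
      have : 2 * (K : ℝ) + 1 ≤ 2 * (q - p₂ + 1) := by nlinarith [hp₂'.2, hq'.2]
      exact_mod_cast this
    exact related_of_annulus hsymm htrans hgaps (p := p₂) (q := q) (by omega) hp₂1 (by omega)
      (by push_cast; omega) (by push_cast; omega) le_rfl (fun i j _ _ h1 h2 => hRfar i j h1 h2)
      (hmem u hu) (hmem v hv)

end GBM

namespace GBM

open MeasureTheory ProbabilityTheory Filter Topology
open scoped ENNReal

/-! ### Asymptotics -/

/-- `log n / n` at `n = 2m`. -/
noncomputable def scale (m : ℕ) : ℝ := Real.log (2 * m : ℕ) / (2 * m : ℕ)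

theorem tendsto_two_mul_cast : Tendsto (fun m : ℕ => ((2 * m : ℕ) : ℝ)) atTop atTop :=
  tendsto_natCast_atTop_atTop.comp (tendsto_id.const_mul_atTop' two_pos)

theorem tendsto_scale : Tendsto scale atTop (𝓝 0) :=
  (Real.isLittleO_log_id_atTop.tendsto_div_nhds_zero).comp tendsto_two_mul_cast

theorem scale_pos {m : ℕ} (hm : 1 ≤ m) : 0 < scale m := by
  have h : (1 : ℝ) < (2 * m : ℕ) := by exact_mod_cast (by omega : 1 < 2 * m)
  exact div_pos (Real.log_pos h) (by linarith)

theorem mul_scale {m : ℕ} (hm : 1 ≤ m) : ((2 * m : ℕ) : ℝ) * scale m = Real.log (2 * m : ℕ) := by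
  have h : (1 : ℝ) < (2 * m : ℕ) := by exact_mod_cast (by omega : 1 < 2 * m)
  rw [scale, mul_div_cancel₀]
  linarith

theorem tendsto_log_mul_exp {ρ : ℝ} (hρ : 1 < ρ) : Tendsto (fun m : ℕ =>
    ((2 * m : ℕ) : ℝ) * Real.exp (-ρ * Real.log (2 * m : ℕ)) * Real.log (2 * m : ℕ)) atTop
    (𝓝 0) := by
  have h := ((isLittleO_log_rpow_atTop (sub_pos.2 hρ)).tendsto_div_nhds_zero).comp
    tendsto_two_mul_cast
  refine h.congr' ?_
  filter_upwards [eventually_ge_atTop 1] with m hm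
  have hn : (0 : ℝ) < (2 * m : ℕ) := by exact_mod_cast (by omega : 0 < 2 * m)
  rw [Function.comp_apply, mul_comm (-ρ), Real.exp_mul, Real.exp_log hn, Real.rpow_sub hn,
    Real.rpow_one, Real.rpow_neg hn.le]
  have : ((2 * m : ℕ) : ℝ) ^ ρ ≠ 0 := (Real.rpow_pos_of_pos hn _).ne'
  field_simp

theorem tendsto_mul_exp {ρ : ℝ} (hρ : 1 < ρ) : Tendsto (fun m : ℕ =>
    ((2 * m : ℕ) : ℝ) * Real.exp (-ρ * Real.log (2 * m : ℕ))) atTop (𝓝 0) := by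
  have h := (tendsto_rpow_neg_atTop (sub_pos.2 hρ)).comp tendsto_two_mul_cast
  refine h.congr' ?_
  filter_upwards [eventually_ge_atTop 1] with m hm
  have hn : (0 : ℝ) < (2 * m : ℕ) := by exact_mod_cast (by omega : 0 < 2 * m)
  rw [Function.comp_apply, mul_comm (-ρ), Real.exp_mul, Real.exp_log hn, neg_sub,
    Real.rpow_sub hn, Real.rpow_one, Real.rpow_neg hn.le]
  rfl

/-- The union bound over pairs of vertices. -/
theorem tendsto_measure_exists_pair {a C ρ : ℝ} (hρ : 1 < ρ)
    {Bad : (m : ℕ) → Fin (2 * m) → Fin (2 * m) → Set (Fin (2 * m) → ℝ)}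
    (h : ∀ᶠ m in atTop, ∀ u v, locations (2 * m) (Bad m u v) ≤
      ENNReal.ofReal (Real.exp (C - ρ * ((2 * m : ℕ) * scale m)) * (2 * (a * scale m)))) :
    Tendsto (fun m => locations (2 * m) {X | ∃ u v, X ∈ Bad m u v}) atTop (𝓝 0) := by
  have hlim : Tendsto (fun m : ℕ => ENNReal.ofReal (2 * a * Real.exp C * (((2 * m : ℕ) : ℝ) *
      Real.exp (-ρ * Real.log (2 * m : ℕ)) * Real.log (2 * m : ℕ)))) atTop (𝓝 0) := by
    have := ENNReal.tendsto_ofReal ((tendsto_log_mul_exp hρ).const_mul (2 * a * Real.exp C))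
    rwa [mul_zero, ENNReal.ofReal_zero] at this
  refine tendsto_of_tendsto_of_tendsto_of_le_of_le' tendsto_const_nhds hlim
    (Eventually.of_forall fun _ => zero_le) ?_
  filter_upwards [h, eventually_ge_atTop 1] with m hm hm1
  have hset : {X | ∃ u v, X ∈ Bad m u v} = ⋃ u, ⋃ v, Bad m u v := by
    ext X
    simp
  rw [hset]
  calc _ ≤ ∑ u, ∑ v, locations (2 * m) (Bad m u v) :=
        (measure_iUnion_fintype_le _ _).trans
          (Finset.sum_le_sum fun u _ => measure_iUnion_fintype_le _ _)
    _ ≤ ∑ _u : Fin (2 * m), ∑ _v : Fin (2 * m), ENNReal.ofReal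
        (Real.exp (C - ρ * ((2 * m : ℕ) * scale m)) * (2 * (a * scale m))) :=
        Finset.sum_le_sum fun u _ => Finset.sum_le_sum fun v _ => hm u v
    _ = _ := by
      rw [Finset.sum_const, Finset.sum_const, Finset.card_univ, Fintype.card_fin, nsmul_eq_mul,
        nsmul_eq_mul, ← ENNReal.ofReal_natCast, ← ENNReal.ofReal_mul (Nat.cast_nonneg _),
        ← ENNReal.ofReal_mul (Nat.cast_nonneg _)]
      congr 1
      rw [← mul_scale hm1, sub_eq_add_neg, Real.exp_add, neg_mul]
      ring

/-! ### Empty cells -/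

theorem unif_cells_le {N : ℕ} (hN : 0 < N) {J : Finset ℤ} (hJ : J ⊆ Finset.Ico 0 (N : ℤ)) :
    unif {t | ⌊N * t⌋ ∉ J} ≤ ENNReal.ofReal (Real.exp (-(J.card / N))) := by
  have hN' : (0 : ℝ) < N := by exact_mod_cast hN
  have hm : MeasurableSet {t : ℝ | ⌊N * t⌋ ∈ J} :=
    (Int.measurable_floor.comp (measurable_const_mul (N : ℝ))) (J : Set ℤ).to_countable.measurableSet
  have hU : {t : ℝ | ⌊N * t⌋ ∈ J} = ⋃ j ∈ J, Set.Ico (j / N : ℝ) ((j + 1) / N) := by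
    ext t
    simp only [Set.mem_ofPred_eq, Set.mem_iUnion, Set.mem_Ico, exists_prop]
    constructor
    · intro ht
      refine ⟨_, ht, ?_, ?_⟩
      · rw [div_le_iff₀ hN', mul_comm]; exact Int.floor_le _
      · rw [lt_div_iff₀ hN', mul_comm]; exact Int.lt_floor_add_one _
    · rintro ⟨j, hj, h1, h2⟩
      rw [div_le_iff₀ hN', mul_comm] at h1
      rw [lt_div_iff₀ hN', mul_comm] at h2
      rwa [Int.floor_eq_iff.2 ⟨h1, h2⟩]
  have hmeas : unif.real {t : ℝ | ⌊N * t⌋ ∈ J} = J.card / N := by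
    rw [measureReal_def, hU, measure_biUnion_finset]
    · have : ∀ j ∈ J, unif (Set.Ico (j / N : ℝ) ((j + 1) / N)) = ENNReal.ofReal (1 / N) := by
        intro j hj
        have hj' := Finset.mem_Ico.1 (hJ hj)
        have h0 : (0 : ℝ) ≤ j := by exact_mod_cast hj'.1
        have h1 : (j : ℝ) + 1 ≤ N := by exact_mod_cast hj'.2
        rw [unif, Measure.restrict_eq_self, Real.volume_Ico]
        · congr 1
          ring
        · refine Set.Ico_subset_Icc_self.trans (Set.Icc_subset_Icc (by positivity) ?_)
          rwa [div_le_one hN']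
      rw [Finset.sum_congr rfl this, Finset.sum_const, nsmul_eq_mul, ENNReal.toReal_mul,
        ENNReal.toReal_natCast, ENNReal.toReal_ofReal (by positivity)]
      ring
    · intro i _ j _ hij
      refine Set.disjoint_left.2 fun t hi hj => hij ?_
      obtain ⟨h1, h2⟩ := hi
      obtain ⟨h3, h4⟩ := hj
      rw [div_le_iff₀ hN', mul_comm] at h1 h3
      rw [lt_div_iff₀ hN', mul_comm] at h2 h4
      rw [← Int.floor_eq_iff.2 ⟨h1, h2⟩, ← Int.floor_eq_iff.2 ⟨h3, h4⟩]
    · exact fun j _ => measurableSet_Ico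
  have hc : {t : ℝ | ⌊N * t⌋ ∉ J} = {t : ℝ | ⌊N * t⌋ ∈ J}ᶜ := rfl
  rw [hc, ← ofReal_measureReal, probReal_compl_eq_one_sub hm, hmeas]
  refine ENNReal.ofReal_le_ofReal ?_
  linarith [Real.add_one_le_exp (-(J.card / N : ℝ))]

theorem locations_cells_le {n N : ℕ} (hN : 0 < N) (V : Finset (Fin n)) {J : Finset ℤ}
    (hJ : J ⊆ Finset.Ico 0 (N : ℤ)) :
    locations n {X | ∀ u ∈ V, ⌊N * X u⌋ ∉ J} ≤
      ENNReal.ofReal (Real.exp (-(J.card * V.card / N))) := by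
  classical
  have hset : {X : Fin n → ℝ | ∀ u ∈ V, ⌊N * X u⌋ ∉ J} =
      Set.pi Set.univ fun u => if u ∈ V then {t : ℝ | ⌊N * t⌋ ∉ J} else Set.univ := by
    ext X
    simp only [Set.mem_ofPred_eq, Set.mem_pi, Set.mem_univ, true_implies]
    refine forall_congr' fun u => ?_
    split_ifs with h <;> simp [h]
  rw [hset, locations_eq, Measure.pi_pi]
  calc _ ≤ ∏ u, (if u ∈ V then ENNReal.ofReal (Real.exp (-(J.card / N))) else 1) := by
        refine Finset.prod_le_prod' fun u _ => ?_
        split_ifs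
        · exact unif_cells_le hN hJ
        · exact prob_le_one
    _ = _ := by
      rw [Finset.prod_ite_mem, Finset.univ_inter, Finset.prod_const,
        ← ENNReal.ofReal_pow (Real.exp_pos _).le, ← Real.exp_nat_mul]
      congr 2
      ring

/-- A union bound over `N` starting cells and at most `2 ^ M` sets of `k` cells. `M ≤ N` keeps the
cells of a window distinct modulo `N`. -/
theorem locations_not_fewGaps_le {n N M k : ℕ} (hN : 0 < N) (hMN : M ≤ N) (V : Finset (Fin n)) :
    locations n {X | ¬ FewGaps (cells V N X) M k} ≤
      ENNReal.ofReal (N * 2 ^ M * Real.exp (-(k * V.card / N))) := by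
  classical
  have hN' : (0 : ℤ) < N := by exact_mod_cast hN
  have hMN' : (M : ℤ) ≤ N := by exact_mod_cast hMN
  set J : ℕ → Finset ℤ → Finset ℤ := fun x F => F.image fun i => (x + i) % N with hJ
  have hsub : {X : Fin n → ℝ | ¬ FewGaps (cells V N X) M k} ⊆
      ⋃ x ∈ Finset.range N, ⋃ F ∈ (Finset.Ico (0 : ℤ) M).powerset.filter fun F => F.card = k,
        {X | ∀ u ∈ V, ⌊N * X u⌋ % (N : ℤ) ∉ J x F} := by
    intro X hX
    simp only [Set.mem_ofPred_eq, FewGaps] at hX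
    push Not at hX
    obtain ⟨x, F, hF, hk, hX⟩ := hX
    obtain ⟨F', hF', hk'⟩ := Finset.exists_subset_card_eq hk
    have hx0 := Int.emod_nonneg x hN'.ne'
    have hxN := Int.emod_lt_of_pos x hN'
    simp only [Set.mem_iUnion, exists_prop]
    refine ⟨(x % N).toNat, Finset.mem_range.2 (by omega), F'.image (· - x),
      Finset.mem_filter.2 ⟨Finset.mem_powerset.2 ?_, ?_⟩, ?_⟩
    · intro i hi
      obtain ⟨j, hj, rfl⟩ := Finset.mem_image.1 hi
      have := Finset.mem_Ico.1 (hF (hF' hj))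
      rw [Finset.mem_Ico]
      omega
    · rw [Finset.card_image_of_injective _ (sub_left_injective), hk']
    · intro u hu hmem
      simp only [hJ, Finset.mem_image] at hmem
      obtain ⟨i, ⟨j, hj, rfl⟩, hi⟩ := hmem
      refine hX j (hF' hj) ⟨u, hu, ?_⟩
      rw [Int.toNat_of_nonneg hx0, Int.emod_add_emod, add_sub_cancel] at hi
      exact hi
  have hJcard : ∀ x : ℕ, ∀ F ⊆ Finset.Ico (0 : ℤ) M, (J x F).card = F.card := by
    intro x F hF
    refine Finset.card_image_of_injOn fun i hi j hj hij => ?_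
    have hi' := Finset.mem_Ico.1 (hF hi)
    have hj' := Finset.mem_Ico.1 (hF hj)
    have h1 : i ≡ j [ZMOD N] := Int.ModEq.add_left_cancel' (x : ℤ) hij
    rw [Int.ModEq, Int.emod_eq_of_lt hi'.1 (by omega), Int.emod_eq_of_lt hj'.1 (by omega)] at h1
    exact h1
  have hJsub : ∀ x F, J x F ⊆ Finset.Ico 0 (N : ℤ) := by
    intro x F i hi
    obtain ⟨j, -, rfl⟩ := Finset.mem_image.1 hi
    exact Finset.mem_Ico.2 ⟨Int.emod_nonneg _ hN'.ne', Int.emod_lt_of_pos _ hN'⟩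
  -- The point `1` has cell number `N`, which is outside the range of residues; it is discarded as a
  -- null event.
  have hae : ∀ᵐ X ∂locations n, ∀ u, X u ∈ Set.Ico (0 : ℝ) 1 := by
    rw [ae_all_iff]
    intro u
    have h : ∀ᵐ t ∂unif, t ∈ Set.Ico (0 : ℝ) 1 := by
      rw [unif, Measure.restrict_congr_set Ico_ae_eq_Icc.symm]
      exact ae_restrict_mem measurableSet_Ico
    exact (measurePreserving_eval (fun _ : Fin n => unif) u).quasiMeasurePreserving.ae h
  have hone : ∀ x : ℕ, ∀ F ∈ (Finset.Ico (0 : ℤ) M).powerset.filter fun F => F.card = k,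
      locations n {X | ∀ u ∈ V, ⌊N * X u⌋ % (N : ℤ) ∉ J x F} ≤
        ENNReal.ofReal (Real.exp (-(k * V.card / N))) := by
    intro x F hF
    rw [Finset.mem_filter, Finset.mem_powerset] at hF
    have h := locations_cells_le hN V (hJsub x F)
    rw [hJcard x F hF.1, hF.2] at h
    refine (measure_mono_ae ?_).trans h
    filter_upwards [hae] with X hX hX' u hu
    have h0 : 0 ≤ ⌊N * X u⌋ := Int.floor_nonneg.2 (mul_nonneg (Nat.cast_nonneg _) (hX u).1)
    have h1 : ⌊N * X u⌋ < N := by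
      rw [Int.floor_lt]
      have : (0 : ℝ) < N := by exact_mod_cast hN
      have := (hX u).2
      push_cast
      nlinarith
    have := hX' u hu
    rwa [Int.emod_eq_of_lt h0 h1] at this
  calc _ ≤ ∑ x ∈ Finset.range N, ∑ F ∈ (Finset.Ico (0 : ℤ) M).powerset.filter fun F => F.card = k,
        locations n {X | ∀ u ∈ V, ⌊N * X u⌋ % (N : ℤ) ∉ J x F} :=
        (measure_mono hsub).trans ((measure_biUnion_finset_le _ _).trans
          (Finset.sum_le_sum fun x _ => measure_biUnion_finset_le _ _))
    _ ≤ ∑ x ∈ Finset.range N, ∑ F ∈ (Finset.Ico (0 : ℤ) M).powerset.filter fun F => F.card = k,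
        ENNReal.ofReal (Real.exp (-(k * V.card / N))) :=
        Finset.sum_le_sum fun x _ => Finset.sum_le_sum fun F hF => hone x F hF
    _ ≤ N * (2 ^ M * ENNReal.ofReal (Real.exp (-(k * V.card / N)))) := by
      rw [Finset.sum_const, Finset.sum_const, Finset.card_range, nsmul_eq_mul, nsmul_eq_mul]
      gcongr
      have : ((Finset.Ico (0 : ℤ) M).powerset.filter fun F => F.card = k).card ≤ 2 ^ M := by
        refine (Finset.card_filter_le _ _).trans ?_
        rw [Finset.card_powerset, Int.card_Ico]
        simp
      exact_mod_cast this
    _ = _ := by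
      rw [mul_assoc (N : ℝ), ENNReal.ofReal_mul (Nat.cast_nonneg _),
        ENNReal.ofReal_mul (by positivity), ENNReal.ofReal_natCast,
        ENNReal.ofReal_pow two_pos.le, ENNReal.ofReal_ofNat]

/-- The number of cells. -/
noncomputable def numCells (K m : ℕ) : ℕ := ⌈(K : ℝ) / scale m⌉₊

theorem numCells_bounds (K : ℕ) : ∀ᶠ m in atTop,
    (K : ℝ) ≤ numCells K m * scale m ∧ numCells K m * scale m ≤ (K : ℝ) + 1 := by
  filter_upwards [eventually_ge_atTop 1, tendsto_scale.eventually (gt_mem_nhds one_pos)]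
    with m hm h1
  have h0 := scale_pos hm
  have hK : (0 : ℝ) ≤ K / scale m := by positivity
  constructor
  · rw [← div_le_iff₀ h0]
    exact Nat.le_ceil _
  · have h2 : (numCells K m : ℝ) ≤ K / scale m + 1 := (Nat.ceil_lt_add_one hK).le
    have h3 : K / scale m * scale m = K := div_mul_cancel₀ _ h0.ne'
    nlinarith

theorem tendsto_numCells {K : ℕ} (hK : 0 < K) : Tendsto (numCells K) atTop atTop := by
  refine tendsto_nat_ceil_atTop.comp ?_
  have h : Tendsto scale atTop (𝓝[>] 0) := tendsto_nhdsWithin_iff.2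
    ⟨tendsto_scale, (eventually_ge_atTop 1).mono fun m hm => scale_pos hm⟩
  have hK' : (0 : ℝ) < K := by exact_mod_cast hK
  simp only [div_eq_mul_inv]
  exact h.inv_tendsto_nhdsGT_zero.const_mul_atTop hK'

theorem tendsto_not_fewGaps {K k : ℕ} (M : ℕ) (hK : 0 < K) (hk : 2 * K < k)
    (V : (m : ℕ) → Finset (Fin (2 * m))) (hV : ∀ m, (V m).card = m) :
    Tendsto (fun m => locations (2 * m) {X | ¬ FewGaps (cells (V m) (numCells K m) X) M k}) atTop
      (𝓝 0) := by
  have hK' : (0 : ℝ) < K := by exact_mod_cast hK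
  have hk' : 2 * (K : ℝ) < k := by exact_mod_cast hk
  obtain ⟨ρ, hρ, hρk⟩ : ∃ ρ : ℝ, 1 < ρ ∧ ρ < k / (2 * K) :=
    exists_between ((one_lt_div (by positivity)).2 hk')
  rw [lt_div_iff₀ (by positivity)] at hρk
  have hlim : Tendsto (fun m : ℕ => ENNReal.ofReal ((K + 1) / Real.log 2 * 2 ^ M *
      (((2 * m : ℕ) : ℝ) * Real.exp (-ρ * Real.log (2 * m : ℕ))))) atTop (𝓝 0) := by
    have := ENNReal.tendsto_ofReal
      ((tendsto_mul_exp hρ).const_mul ((K + 1) / Real.log 2 * 2 ^ M))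
    rwa [mul_zero, ENNReal.ofReal_zero] at this
  have hsmall : ∀ᶠ m in atTop, ρ * (2 * scale m) < k - ρ * (2 * K) := by
    have : Tendsto (fun m => ρ * (2 * scale m)) atTop (𝓝 (ρ * (2 * 0))) :=
      (tendsto_scale.const_mul 2).const_mul ρ
    rw [mul_zero, mul_zero] at this
    exact this.eventually (gt_mem_nhds (by linarith))
  refine tendsto_of_tendsto_of_tendsto_of_le_of_le' tendsto_const_nhds hlim
    (Eventually.of_forall fun _ => zero_le) ?_
  filter_upwards [eventually_ge_atTop 1, (tendsto_numCells hK).eventually_ge_atTop (M + 1),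
    numCells_bounds K, hsmall] with m hm hMN hb hsm
  refine (locations_not_fewGaps_le (by omega) (by omega) (V m)).trans
    (ENNReal.ofReal_le_ofReal ?_)
  rw [hV m]
  have h0 := scale_pos hm
  have hms := mul_scale hm
  have hN : (0 : ℝ) < numCells K m := by
    have : 0 < numCells K m := by omega
    exact_mod_cast this
  have hlog : Real.log 2 ≤ Real.log (2 * m : ℕ) := Real.log_le_log two_pos (by
    exact_mod_cast (by omega : 2 ≤ 2 * m))
  have hlog2 : 0 < Real.log 2 := Real.log_pos one_lt_two
  have hNn : (numCells K m : ℝ) ≤ (K + 1) / Real.log 2 * (2 * m : ℕ) := by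
    rw [div_mul_eq_mul_div, le_div_iff₀ hlog2]
    have h1 : (numCells K m : ℝ) * scale m * (2 * m : ℕ) ≤ (K + 1) * (2 * m : ℕ) :=
      mul_le_mul_of_nonneg_right hb.2 (Nat.cast_nonneg _)
    have h2 : (numCells K m : ℝ) * scale m * (2 * m : ℕ) =
        numCells K m * Real.log (2 * m : ℕ) := by
      rw [← hms]; ring
    rw [h2] at h1
    exact (mul_le_mul_of_nonneg_left hlog hN.le).trans h1
  have hexp : -(k * m / numCells K m : ℝ) ≤ -ρ * Real.log (2 * m : ℕ) := by
    rw [neg_mul, neg_le_neg_iff, le_div_iff₀ hN, ← hms]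
    -- The bound `K + 1` is too crude here: since only `2 * K < k` is known, the rounding error has
    -- to tend to `0`.
    have h3 : numCells K m * scale m ≤ (K : ℝ) + scale m := by
      have h2 : (numCells K m : ℝ) ≤ K / scale m + 1 := (Nat.ceil_lt_add_one (by positivity)).le
      have h3 : K / scale m * scale m = K := div_mul_cancel₀ _ h0.ne'
      nlinarith
    have h4 : ρ * (2 * (numCells K m * scale m)) ≤ k := by nlinarith
    have h5 : (0 : ℝ) ≤ m := Nat.cast_nonneg _
    push_cast
    nlinarith
  have hE := Real.exp_le_exp.2 hexp
  calc (numCells K m : ℝ) * 2 ^ M * Real.exp (-(k * m / numCells K m))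
      ≤ (K + 1) / Real.log 2 * (2 * m : ℕ) * 2 ^ M * Real.exp (-ρ * Real.log (2 * m : ℕ)) := by
        gcongr
    _ = _ := by ring

end GBM

namespace GBM

open MeasureTheory ProbabilityTheory Filter Topology
open scoped ENNReal

/-! ### Recovery -/

/-- An edge between the parts whose count reaches the upper threshold. -/
def badUpper (a b t L : ℝ) {n : ℕ} (V : Finset (Fin n)) (u v : Fin n) : Set (Fin n → ℝ) :=
  {X | (u ≠ v ∧ ¬ (u ∈ V ↔ v ∈ V)) ∧ (X u, X v) ∈ closePairs (b * L) ∧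
    (2 * b + t) * (n * L) ≤ (commonCount (graph V (a * L) (b * L) X) u v).val}

/-- An edge between the parts whose count is at most the lower threshold. -/
def badLower (a b t L : ℝ) {n : ℕ} (V : Finset (Fin n)) (u v : Fin n) : Set (Fin n → ℝ) :=
  {X | (u ≠ v ∧ ¬ (u ∈ V ↔ v ∈ V)) ∧ (X u, X v) ∈ closePairs (b * L) ∧
    (commonCount (graph V (a * L) (b * L) X) u v).val ≤ (2 * b - t) * (n * L)}

/-- A short edge inside a part whose count is at most the upper threshold. -/
def badNear (a b t s L : ℝ) {n : ℕ} (V : Finset (Fin n)) (u v : Fin n) : Set (Fin n → ℝ) :=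
  {X | (u ≠ v ∧ (u ∈ V ↔ v ∈ V)) ∧
    (X u, X v) ∈ closePairs (a * L) ∩ {p | dL p.1 p.2 < s * L} ∧
    (commonCount (graph V (a * L) (b * L) X) u v).val ≤ (2 * b + t) * (n * L)}

/-- A long edge inside a part whose count reaches the lower threshold. -/
def badFar (a b t s L : ℝ) {n : ℕ} (V : Finset (Fin n)) (u v : Fin n) : Set (Fin n → ℝ) :=
  {X | (u ≠ v ∧ (u ∈ V ↔ v ∈ V)) ∧
    (X u, X v) ∈ closePairs (a * L) ∩ {p | s * L < dL p.1 p.2} ∧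
    (2 * b - t) * (n * L) ≤ (commonCount (graph V (a * L) (b * L) X) u v).val}

theorem measure_setOf_and_le {α : Type*} [MeasurableSpace α] {μ : Measure α} {P : Prop}
    {S : Set α} {c : ℝ≥0∞} (h : P → μ S ≤ c) : μ {x | P ∧ x ∈ S} ≤ c := by
  by_cases hP : P
  · simpa [hP] using h hP
  · simp [hP]

theorem eventually_scale_small (a : ℝ) : ∀ᶠ m in atTop,
    1 ≤ m ∧ 0 < scale m ∧ scale m ≤ 1 ∧ 3 * (a * scale m) ≤ 1 := by
  have h : Tendsto (fun m => 3 * (a * scale m)) atTop (𝓝 (3 * (a * 0))) :=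
    (tendsto_scale.const_mul a).const_mul 3
  rw [mul_zero, mul_zero] at h
  filter_upwards [eventually_ge_atTop 1, tendsto_scale.eventually (gt_mem_nhds one_pos),
    h.eventually (gt_mem_nhds one_pos)] with m h1 h2 h3
  exact ⟨h1, scale_pos h1, h2.le, h3.le⟩

section

variable {a b t s : ℝ} (hb : 0 < b) (hab : 2 * b ≤ a) {V : (m : ℕ) → Finset (Fin (2 * m))}
  (hV : ∀ m, (V m).card = m)

include hb hab

theorem tendsto_badUpper (h : CrossUpper b t) : Tendsto (fun m =>
    locations (2 * m) {X | ∃ u v, X ∈ badUpper a b t (scale m) (V m) u v}) atTop (𝓝 0) := by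
  obtain ⟨g, hg, h⟩ := h
  refine tendsto_measure_exists_pair (a := a) (C := 0) h ?_
  filter_upwards [eventually_scale_small a] with m hm u v
  refine measure_setOf_and_le fun huv => ?_
  refine (cross_upper_tail hb hab hm.2.1 hm.2.2.2 (V m) huv.1 huv.2 hg (t := t)).trans_eq ?_
  congr 3
  ring

theorem tendsto_badLower (h : CrossLower b t) : Tendsto (fun m =>
    locations (2 * m) {X | ∃ u v, X ∈ badLower a b t (scale m) (V m) u v}) atTop (𝓝 0) := by
  obtain ⟨g, hg, hg1, h⟩ := h
  refine tendsto_measure_exists_pair (a := a) (C := 4 * b) h ?_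
  filter_upwards [eventually_scale_small a] with m hm u v
  refine measure_setOf_and_le fun huv => ?_
  exact cross_lower_tail hb hab hm.2.1 hm.2.2.2 (V m) huv.1 huv.2 hg hg1 hm.2.2.1

include hV

theorem tendsto_badNear (hs : 0 ≤ s) (h : s = 0 ∨ NearExponent a b t s) : Tendsto (fun m =>
    locations (2 * m) {X | ∃ u v, X ∈ badNear a b t s (scale m) (V m) u v}) atTop (𝓝 0) := by
  rcases h with rfl | ⟨g, hg, hg1, h⟩
  -- The default `s = 0`: no pair has negative distance.
  · have hempty : ∀ m, {X | ∃ u v, X ∈ badNear a b t 0 (scale m) (V m) u v} = ∅ := by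
      intro m
      refine Set.eq_empty_of_forall_notMem ?_
      rintro X ⟨u, v, -, ⟨⟨⟨hu, hv⟩, -⟩, h⟩, -⟩
      simp only [Set.mem_ofPred_eq, zero_mul] at h hu hv
      rw [dL_eq_dist hu hv] at h
      exact absurd dist_nonneg h.not_ge
    simp only [hempty, measure_empty]
    exact tendsto_const_nhds
  refine tendsto_measure_exists_pair (a := a) (C := 4 * a) h ?_
  filter_upwards [eventually_scale_small a] with m hm u v
  refine measure_setOf_and_le fun huv => ?_
  exact near_tail hb hab hm.2.1 hm.2.2.2 (hV m) huv.1 huv.2 hg hg1 hm.2.2.1 hs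

theorem tendsto_badFar (hsa : s ≤ a) (h : s = a ∨ (2 * b ≤ s ∧ FarExponent a b t s)) :
    Tendsto (fun m => locations (2 * m) {X | ∃ u v, X ∈ badFar a b t s (scale m) (V m) u v})
      atTop (𝓝 0) := by
  rcases h with rfl | ⟨hs, g, hg1, h⟩
  -- The default `s = a`: no edge inside a part is longer than `a L`.
  · have hempty : ∀ m, {X | ∃ u v, X ∈ badFar s b t s (scale m) (V m) u v} = ∅ := by
      intro m
      refine Set.eq_empty_of_forall_notMem ?_
      rintro X ⟨u, v, -, ⟨⟨-, h'⟩, h⟩, -⟩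
      exact absurd h' (not_le_of_gt h)
    simp only [hempty, measure_empty]
    exact tendsto_const_nhds
  refine tendsto_measure_exists_pair (a := a) (C := 0) h ?_
  filter_upwards [eventually_scale_small a] with m hm u v
  refine measure_setOf_and_le fun huv => ?_
  refine (far_tail hb hab hm.2.1 hm.2.2.2 (hV m) huv.1 huv.2 hg1 hs hsa (t := t)).trans_eq ?_
  congr 3
  ring

end

theorem ae_mem_Icc (n : ℕ) : ∀ᵐ X ∂locations n, ∀ u, X u ∈ Set.Icc (0 : ℝ) 1 := by
  rw [ae_all_iff]
  intro u
  have h : ∀ᵐ t ∂unif, t ∈ Set.Icc (0 : ℝ) 1 := ae_restrict_mem measurableSet_Icc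
  exact (measurePreserving_eval (fun _ : Fin n => unif) u).quasiMeasurePreserving.ae h

/-- Off the bad events the algorithm recovers the parts. -/
theorem label_eq_iff_of_good {a b t₁ t₂ s₁ s₂ L : ℝ} {n : ℕ} (hn : 0 < n) {V : Finset (Fin n)}
    {X : Fin n → ℝ} (hX : ∀ u, X u ∈ Set.Icc (0 : ℝ) 1)
    (h1 : ∀ u v, X ∉ badUpper a b t₁ L V u v) (h2 : ∀ u v, X ∉ badLower a b t₂ L V u v)
    (h3 : ∀ u v, X ∉ badNear a b t₁ s₁ L V u v) (h4 : ∀ u v, X ∉ badFar a b t₂ s₂ L V u v)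
    (hconn : ∀ W : Finset (Fin n), (W = V ∨ W = Vᶜ) → ∀ r : Setoid (Fin n),
      (∀ u ∈ W, ∀ v ∈ W, u ≠ v → dL (X u) (X v) < s₁ * L → dL (X u) (X v) ≤ a * L → r u v) →
      (∀ u ∈ W, ∀ v ∈ W, u ≠ v → s₂ * L < dL (X u) (X v) → dL (X u) (X v) ≤ a * L → r u v) →
      ∀ u ∈ W, ∀ v ∈ W, r u v) (u v : Fin n) :
    (recoverClusters (graph V (a * L) (b * L) X) ((2 * b + t₁) * L) ((2 * b - t₂) * L)).val u =
      (recoverClusters (graph V (a * L) (b * L) X) ((2 * b + t₁) * L) ((2 * b - t₂) * L)).val v ↔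
      (u ∈ V ↔ v ∈ V) := by
  have hn' : (0 : ℝ) < n := by exact_mod_cast hn
  refine label_eq_iff (fun u v huv => ?_) (fun r hr u v huv => ?_) u v
  · obtain ⟨hadj, hcount⟩ := huv
    rw [graph_adj] at hadj
    by_contra hs
    rw [radius, if_neg hs] at hadj
    rcases hcount with hc | hc
    · rw [le_div_iff₀ hn'] at hc
      exact h1 u v ⟨⟨hadj.1, hs⟩, ⟨⟨hX u, hX v⟩, hadj.2⟩, by linarith⟩
    · rw [div_le_iff₀ hn'] at hc
      exact h2 u v ⟨⟨hadj.1, hs⟩, ⟨⟨hX u, hX v⟩, hadj.2⟩, by linarith⟩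
  · have hnear : ∀ u v, (u ∈ V ↔ v ∈ V) → u ≠ v → dL (X u) (X v) < s₁ * L →
        dL (X u) (X v) ≤ a * L → r u v := by
      intro u v hs huv hd1 hd2
      refine hr u v ⟨graph_adj.2 ⟨huv, by rwa [radius, if_pos hs]⟩, Or.inl ?_⟩
      by_contra! hc
      rw [div_lt_iff₀ hn'] at hc
      exact h3 u v ⟨⟨huv, hs⟩, ⟨⟨⟨hX u, hX v⟩, hd2⟩, hd1⟩, by linarith⟩
    have hfar : ∀ u v, (u ∈ V ↔ v ∈ V) → u ≠ v → s₂ * L < dL (X u) (X v) →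
        dL (X u) (X v) ≤ a * L → r u v := by
      intro u v hs huv hd1 hd2
      refine hr u v ⟨graph_adj.2 ⟨huv, by rwa [radius, if_pos hs]⟩, Or.inr ?_⟩
      by_contra! hc
      rw [lt_div_iff₀ hn'] at hc
      exact h4 u v ⟨⟨huv, hs⟩, ⟨⟨⟨hX u, hX v⟩, hd2⟩, hd1⟩, by linarith⟩
    have hpart : ∀ W : Finset (Fin n), (W = V ∨ W = Vᶜ) → ∀ u ∈ W, ∀ v ∈ W, r u v := by
      intro W hW
      have hsame : ∀ u ∈ W, ∀ v ∈ W, (u ∈ V ↔ v ∈ V) := by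
        intro u hu v hv
        rcases hW with rfl | rfl
        · exact iff_of_true hu hv
        · exact iff_of_false (Finset.mem_compl.1 hu) (Finset.mem_compl.1 hv)
      exact hconn W hW r (fun u hu v hv => hnear u v (hsame u hu v hv))
        fun u hu v hv => hfar u v (hsame u hu v hv)
    by_cases hu : u ∈ V
    · exact hpart V (Or.inl rfl) u hu v (huv.1 hu)
    · exact hpart Vᶜ (Or.inr rfl) u (Finset.mem_compl.2 hu) v
        (Finset.mem_compl.2 fun hv => hu (huv.2 hv))

theorem recoversWhp_of_feasible {a b t₁ t₂ s₁ s₂ : ℝ} (hb : 0 < b) (hab : 2 * b ≤ a)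
    (hu : CrossUpper b t₁) (hl : CrossLower b t₂) (hf : Feasible a b t₁ t₂ s₁ s₂) :
    RecoversWhp a b t₁ t₂ := by
  intro V hV
  obtain ⟨K, k, M, hK, hk, hdisc⟩ :=
    exists_discretization (by linarith) hf.nonneg hf.nonneg' hf.le hf.spread
  have hV' : ∀ m, (V m)ᶜ.card = m := by
    intro m
    rw [Finset.card_compl, hV, Fintype.card_fin]
    omega
  have hlim := (((((tendsto_badUpper (V := V) hb hab hu).add
    (tendsto_badLower (V := V) hb hab hl)).add (tendsto_badNear hb hab hV hf.nonneg hf.near)).add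
    (tendsto_badFar hb hab hV hf.le hf.far)).add (tendsto_not_fewGaps M hK hk V hV)).add
    (tendsto_not_fewGaps M hK hk (fun m => (V m)ᶜ) hV')
  simp only [add_zero] at hlim
  have hlow := ENNReal.Tendsto.sub (tendsto_const_nhds (x := (1 : ℝ≥0∞))) hlim
    (Or.inl ENNReal.one_ne_top)
  rw [tsub_zero] at hlow
  refine tendsto_of_tendsto_of_tendsto_of_le_of_le' hlow tendsto_const_nhds ?_
    (Eventually.of_forall fun m => prob_le_one)
  filter_upwards [eventually_ge_atTop 1, (tendsto_numCells hK).eventually_ge_atTop M,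
    numCells_bounds K] with m hm hMN hNb
  -- The whole space is covered, up to a null set, by the recovery event and six bad events;
  -- subadditivity then suffices, without measurability of the recovery event.
  rw [tsub_le_iff_right, ← measure_univ (μ := locations (2 * m))]
  have hae := ae_mem_Icc (2 * m)
  refine (measure_mono_ae (t := _ ∪ (((((_ ∪ _) ∪ _) ∪ _) ∪ _) ∪ _)) ?_).trans
    ((measure_union_le _ _).trans (add_le_add_right ((measure_union_le _ _).trans
      (add_le_add_left ((measure_union_le _ _).trans (add_le_add_left ((measure_union_le _ _).trans
        (add_le_add_left ((measure_union_le _ _).trans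
          (add_le_add_left (measure_union_le _ _) _)) _)) _)) _)) _))
  filter_upwards [hae] with X hX _
  by_contra hbad
  change X ∉ (_ ∪ (((((_ ∪ _) ∪ _) ∪ _) ∪ _) ∪ _) : Set (Fin (2 * m) → ℝ)) at hbad
  simp only [Set.mem_union, Set.mem_ofPred_eq, not_or, not_exists, not_not] at hbad
  obtain ⟨hgoal, ⟨⟨⟨⟨h1, h2⟩, h3⟩, h4⟩, h5⟩, h6⟩ := hbad
  refine hgoal fun u v => ?_
  simp only [mul_div_assoc, thresholdS, thresholdD]
  refine label_eq_iff_of_good (L := scale m) (by omega) hX h1 h2 h3 h4 ?_ u v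
  rintro W (rfl | rfl) r
  · exact hdisc _ _ _ X (scale m) r hNb.1 hNb.2 hMN hX h5
  · exact hdisc _ _ _ X (scale m) r hNb.1 hNb.2 hMN hX h6

end GBM

theorem theorem4 (a b : ℝ) (hb : 0 < b) (hab : 2 * b ≤ a) :
    -- with `t₁`, `t₂` the two infima, recovery by thresholds just beyond `t₁` and `t₂`
    (GBM.Condition a (GBM.thetaOne a b (GBM.tOne b)) (GBM.thetaTwo a b (GBM.tTwo b)) →
      ∃ ε > 0, ∀ t₁ ∈ Set.Ioo (GBM.tOne b) (GBM.tOne b + ε),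
        ∀ t₂ ∈ Set.Ioo (GBM.tTwo b) (GBM.tTwo b + ε), GBM.RecoversWhp a b t₁ t₂) ∧
    -- the same for any `t₁`, `t₂` that satisfy the strict inequalities
    (∀ t₁ ∈ GBM.upperSet b, ∀ t₂ ∈ GBM.lowerSet b,
      GBM.Condition a (GBM.thetaOne a b t₁) (GBM.thetaTwo a b t₂) →
        GBM.RecoversWhp a b t₁ t₂) ∧
    -- the algorithm runs in polynomial time
    (∃ p : Polynomial ℕ, ∀ (n : ℕ) (G : SimpleGraph (Fin n)) (ES ED : ℝ),
      (GBM.recoverClusters G ES ED).steps ≤ p.eval n) := by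
  refine ⟨fun h => ?_, fun t₁ ht₁ t₂ ht₂ h => ?_, GBM.exists_polynomial_steps_le⟩
  · obtain ⟨s₁, s₂, hf⟩ := GBM.exists_feasible hb hab (GBM.tOne_nonneg b) (GBM.tTwo_nonneg b) h
    obtain ⟨ε, hε, hf⟩ := hf.exists_pos
    exact ⟨ε, hε, fun t₁ ht₁ t₂ ht₂ => GBM.recoversWhp_of_feasible hb hab
      (GBM.crossUpper_of_gt hb ht₁.1) (GBM.crossLower_of_gt hb ht₂.1) (hf t₁ ht₁ t₂ ht₂)⟩
  · obtain ⟨s₁, s₂, hf⟩ := GBM.exists_feasible hb hab ht₁.1.le ht₂.1.le h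
    exact GBM.recoversWhp_of_feasible hb hab (GBM.crossUpper_of_mem hb ht₁)
      (GBM.crossLower_of_mem hb ht₂) hf
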